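/- Let $r\in\mathbb N$, let $W$ be a symmetric $r\times r$ matrix with nonnegative entries, and let $\pi$ be a probability vector on $[r]=\{1,\dots,r\}$. For each $n$, let $G=G_n$ be a random graph on $n$ vertices distributed according to the stochastic block model with parameters $(W,\pi)$: the vertices $v$ receive independent types $\sigma(v)\in[r]$ of law $\pi$, and, given the types, each pair of distinct vertices $u,v$ is joined by an edge, independently of all other pairs, with probability $\min(W_{\sigma(u),\sigma(v)}/n,\,1)$. Let $M=\mathrm{diag}(\pi)\,W$ be the mean progeny matrix. Assume that $M$ is positive regular (for some $t\ge 1$ all entries of $M^t$ are positive), and that there is a constant $\alpha>1$ with $\sum_{i=1}^r M_{ij}=\sum_{i=1}^r \pi_iW_{ij}=\alpha$ for all $j\in[r]$ (so that $\alpha$ is the largest eigenvalue of $M$). For a graph $G$ and a nonnegative integer $\ell$, let $B^{(\ell)}$ be the path expansion matrix of $G$, whose $(i,j)$ entry is the number of self-avoiding paths of length $\ell$ between $i$ and $j$, and let $D^{(\ell)}$ be the distance matrix of $G$, with $D^{(\ell)}_{ij}=1$ if the graph distance $d(i,j)$ equals $\ell$ and $D^{(\ell)}_{ij}=0$ otherwise.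 Let $\rho$ denote the spectral radius of a matrix. **Proposition.** Let $\kappa<1/12$ and let $\ell=\ell_n$ be nonnegative integers with $\ell_n\sim\kappa\log_\alpha n$ as $n\to\infty$. Then, with high probability, $$\rho\bigl(B^{(\ell)}-D^{(\ell)}\bigr)=\widetilde O\bigl(\alpha^{\ell/2}\bigr),$$ that is, there exist (deterministic) constants $C$ and $c$ such that $$\mathbb P\Bigl(\rho\bigl(B^{(\ell_n)}-D^{(\ell_n)}\bigr)\le C\,(\log n)^c\,\alpha^{\ell_n/2}\Bigr)\longrightarrow 1\qquad(n\to\infty).$$ -/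

import Mathlib

open MeasureTheory ProbabilityTheory Filter Asymptotics Topology

/-- The parameters `(W, π)` of a stochastic block model with `r` blocks: a symmetric matrix `W` with
nonnegative entries and a probability vector `π`. -/
structure SBM (r : ℕ) where
  W : Matrix (Fin r) (Fin r) ℝ
  π : Fin r → ℝ
  W_symm : W.IsSymm
  W_nonneg : ∀ i j, 0 ≤ W i j
  π_nonneg : ∀ i, 0 ≤ π i
  π_sum : ∑ i, π i = 1

namespace SBM

variable {r : ℕ} (S : SBM r)

/-- The mean progeny matrix `M = Π W`, with `Π = diag(π)`. -/
def meanProgeny : Matrix (Fin r) (Fin r) ℝ := Matrix.diagonal S.π * S.W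

/-- The law `π` of the type of a single vertex. -/
noncomputable def typePMF : PMF (Fin r) :=
  PMF.ofFintype (fun i => ENNReal.ofReal (S.π i)) (by
    rw [← ENNReal.ofReal_sum_of_nonneg (fun i _ => S.π_nonneg i), S.π_sum, ENNReal.ofReal_one])

/-- Given the types `σ` of the `n` vertices, the probability `min (W_{σ(u),σ(v)} / n) 1` that the
vertices `u` and `v` are joined, as a function of the unordered pair `s(u, v)`. -/
noncomputable def edgeProb {n : ℕ} (σ : Fin n → Fin r) : Sym2 (Fin n) → ℝ :=
  Sym2.lift ⟨fun u v => min (S.W (σ u) (σ v) / n) 1, fun u v => by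
    simp only [S.W_symm.apply (σ v) (σ u)]⟩

theorem edgeProb_mem {n : ℕ} (σ : Fin n → Fin r) (e : Sym2 (Fin n)) :
    S.edgeProb σ e ∈ unitInterval := by
  induction e with
  | h u v =>
    exact ⟨le_min (div_nonneg (S.W_nonneg _ _) (Nat.cast_nonneg n)) zero_le_one, min_le_right _ _⟩

/-- Given the types `σ`, the law of the edge indicators: independent `Bool`-valued variables, one
for each unordered pair `e` of vertices, equal to `true` with probability `edgeProb σ e` (the indicators of the pairs `s(u, u)` play no role). -/
noncomputable def edgeLaw {n : ℕ} (σ : Fin n → Fin r) : Measure (Sym2 (Fin n) → Bool) :=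
  Measure.pi fun e => bernoulliMeasure true false ⟨S.edgeProb σ e, S.edgeProb_mem σ e⟩

instance {n : ℕ} (σ : Fin n → Fin r) : IsProbabilityMeasure (S.edgeLaw σ) := by
  unfold edgeLaw; infer_instance

/-- The conditional law of the edge indicators given the types, as a Markov kernel. -/
noncomputable def edgeKernel (n : ℕ) : Kernel (Fin n → Fin r) (Sym2 (Fin n) → Bool) :=
  Kernel.ofFunOfCountable S.edgeLaw

instance (n : ℕ) : IsMarkovKernel (S.edgeKernel n) :=
  ⟨fun σ => inferInstanceAs (IsProbabilityMeasure (S.edgeLaw σ))⟩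

/-- The stochastic block model on `n` vertices: the joint law of the types, which are independent
with law `π`, and of the edge indicators. -/
noncomputable def law (n : ℕ) : Measure ((Fin n → Fin r) × (Sym2 (Fin n) → Bool)) :=
  (Measure.pi fun _ : Fin n => S.typePMF.toMeasure) ⊗ₘ S.edgeKernel n

instance (n : ℕ) : IsProbabilityMeasure (S.law n) := by
  unfold law; infer_instance

end SBM

/-- The simple graph with given edge indicators: distinct vertices `u`, `v` are adjacent iff
`ω s(u, v) = true`. -/
def graphOf {n : ℕ} (ω : Sym2 (Fin n) → Bool) : SimpleGraph (Fin n) :=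
  SimpleGraph.fromEdgeSet {e | ω e = true}

/-- The path expansion matrix `B^(ℓ)`: its entry `(i, j)` is the number of self-avoiding paths of
length `ℓ` from `i` to `j`. -/
noncomputable def pathExpansionMatrix {n : ℕ} (G : SimpleGraph (Fin n)) (ℓ : ℕ) :
    Matrix (Fin n) (Fin n) ℝ :=
  Matrix.of fun i j => (Nat.card {p : G.Walk i j // p.IsPath ∧ p.length = ℓ} : ℝ)

open Classical in
/-- The distance matrix `D^(ℓ)`: its entry `(i, j)` is `1` if `d(i, j) = ℓ` and `0` otherwise (with
`d(i, j) = ∞` if `i` and `j` are not connected). -/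
noncomputable def distanceMatrix {n : ℕ} (G : SimpleGraph (Fin n)) (ℓ : ℕ) :
    Matrix (Fin n) (Fin n) ℝ :=
  Matrix.of fun i j => if G.edist i j = (ℓ : ℕ∞) then 1 else 0

/-- The spectral radius of a real matrix: the largest modulus of its complex eigenvalues. -/
noncomputable def Matrix.specRadius {n : ℕ} (A : Matrix (Fin n) (Fin n) ℝ) : ENNReal :=
  spectralRadius ℂ (A.map (fun x : ℝ => (x : ℂ)))

/-! Put `A = B^(ℓ) - D^(ℓ)`. Suppose all edges within distance `2ℓ` of `i` lie in a breadth-first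
tree `T` of `i`, except possibly one edge `xy`. Short paths inside this ball are then nearly unique.
If no path of length at most `ℓ` from `j` to `k` uses `xy`, all of them lie in `T`, there is at most
one, and `A j k = 0`. So a nonzero entry forces `d(j,x) + d(x,k) ≤ ℓ`, and its modulus is at most 3,
since a path crosses `xy` forwards, backwards or not at all.

Row sums of `|A|` can be of order `α^ℓ`, for instance when `i` is near `x`. The gain comes from
`|A|²`: if `A i j * A j k ≠ 0`, both paths stay in the ball around `i` and meet the same edge `xy`,
so row `i` of `|A|²` counts pairs `(j,k)` with `d(j,x) + d(x,k) ≤ ℓ`. When spheres of radius `t`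
have size at most `L (t+1) a^t`, there are `Õ(a^ℓ)` such pairs, and the square root of the row sum
bounds the spectral radius (`specRadius_path_sub_distance_le`).

Both conditions hold with high probability for independent edges with expected degrees at most `a`
and probabilities at most `c = O(1/n)`. Sphere sizes have exponential tails, by an exponential
moment bound propagated through the layers of the exploration (`integral_exp_layer_le`). Two extra
edges in the ball of radius `R` around a vertex yield a connected set of at most `4R+1` vertices,
spanned by tree branches to the four endpoints; a union bound over ways to grow it gives probability
at most `polylog · a^(4R) c²` for `R = O(log n)` (`real_not_almostTreeBall_le`). With `R = 2ℓ`,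
summing over `n` vertices gives about `n · α^(8ℓ) / n² ≤ n^(-1/3)`.

Finally the types are random: by Chebyshev, all expected degrees are at most `a = α (1 + 1/log n)`
with high probability, and replacing `a^ℓ` by `α^ℓ` costs only a constant factor since `ℓ = O(log
n)`. -/

namespace SimpleGraph

/-! ### Acyclic graphs, breadth-first trees, and paths in a tree plus one edge. -/

variable {V : Type*}

/-- A graph in which each edge joins some vertex to its parent, where parents have smaller height,
is acyclic. -/
theorem isAcyclic_of_parent {T : SimpleGraph V} (d : V → ℕ) (par : V → V)
    (h : ∀ u v, T.Adj u v → (par v = u ∧ d u < d v) ∨ (par u = v ∧ d v < d u)) :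
    T.IsAcyclic := by
  classical
  intro v c hc
  -- At a vertex of maximal height on a cycle, both cycle neighbours would have to be its parent,
  -- but they are distinct.
  obtain ⟨u, hu, hmax⟩ := c.support.toFinset.exists_max_image d ⟨v, by simp⟩
  rw [List.mem_toFinset] at hu
  have hc' := hc.rotate hu
  have hmax' : ∀ w ∈ (c.rotate u hu).support, d w ≤ d u := by
    intro w hw
    apply hmax
    rw [List.mem_toFinset]
    exact (Walk.mem_support_rotate_iff c u hu).1 hw
  have key : ∀ w ∈ (c.rotate u hu).support, T.Adj u w → par u = w := by
    intro w hw hadj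
    rcases h u w hadj with ⟨-, h2⟩ | ⟨h1, -⟩
    · exact absurd (hmax' w hw) (by omega)
    · exact h1
  have hnn := hc'.not_nil
  apply hc'.snd_ne_penultimate
  exact (key _ (Walk.getVert_mem_support _ _) (Walk.adj_snd hnn)).symm.trans
    (key _ (Walk.getVert_mem_support _ _) (Walk.adj_penultimate hnn).symm)

theorem exists_adj_dist_succ {G : SimpleGraph V} {i v : V} (hr : G.Reachable i v) (hne : i ≠ v) :
    ∃ u, G.Adj u v ∧ G.dist i u + 1 = G.dist i v := by
  obtain ⟨p, hp⟩ := hr.exists_walk_length_eq_dist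
  have hnn : ¬ p.Nil := Walk.not_nil_of_ne hne
  refine ⟨p.penultimate, p.adj_penultimate hnn, ?_⟩
  have h1 : G.dist i p.penultimate ≤ p.dropLast.length := dist_le _
  have h2 := Walk.length_dropLast_add_one hnn
  have h3 : G.dist i v ≤ G.dist i p.penultimate + 1 := by
    obtain ⟨q, hq⟩ := (p.dropLast.reachable).exists_walk_length_eq_dist
    have := dist_le (q.concat (p.adj_penultimate hnn))
    rw [Walk.length_concat, hq] at this
    exact this
  omega

open Classical in
/-- A neighbour of `v` that is closer to `i`, if `v` is reachable from `i` and distinct from it. -/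
noncomputable def bfsParent (G : SimpleGraph V) (i v : V) : V :=
  if h : ∃ u, G.Adj u v ∧ G.dist i u + 1 = G.dist i v then h.choose else v

theorem bfsParent_spec {G : SimpleGraph V} {i v : V} (hr : G.Reachable i v) (hne : i ≠ v) :
    G.Adj (G.bfsParent i v) v ∧ G.dist i (G.bfsParent i v) + 1 = G.dist i v := by
  have h := exists_adj_dist_succ hr hne
  rw [bfsParent, dif_pos h]
  exact h.choose_spec

/-- A breadth-first search tree of the component of `i`. -/
noncomputable def bfsTree (G : SimpleGraph V) (i : V) : SimpleGraph V where
  Adj u v := (G.bfsParent i v = u ∧ G.dist i u < G.dist i v) ∨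
    (G.bfsParent i u = v ∧ G.dist i v < G.dist i u)
  symm := ⟨fun _ _ h => h.symm⟩
  loopless := ⟨fun u h => by simp at h⟩

theorem isAcyclic_bfsTree (G : SimpleGraph V) (i : V) : (G.bfsTree i).IsAcyclic :=
  isAcyclic_of_parent (G.dist i) (G.bfsParent i) fun _ _ h => h

theorem IsAcyclic.eq_of_edges_subset {G T : SimpleGraph V} (hT : T.IsAcyclic) {u v : V}
    {P Q : G.Walk u v} (hP : P.IsPath) (hQ : Q.IsPath) (hPT : ∀ e ∈ P.edges, e ∈ T.edgeSet)
    (hQT : ∀ e ∈ Q.edges, e ∈ T.edgeSet) : P = Q := by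
  have h := (hT.subsingleton_path u v).elim ⟨P.transfer T hPT, hP.transfer hPT⟩
    ⟨Q.transfer T hQT, hQ.transfer hQT⟩
  have h2 : P.transfer T hPT = Q.transfer T hQT := congrArg Subtype.val h
  apply Walk.ext_support
  rw [← Walk.support_transfer P hPT, h2, Walk.support_transfer]

theorem Walk.exists_eq_append_cons {G : SimpleGraph V} {u v : V} (P : G.Walk u v) {x y : V}
    (hd : ∃ d ∈ P.darts, d.toProd = (x, y)) :
    ∃ (P₁ : G.Walk u x) (h : G.Adj x y) (P₂ : G.Walk y v), P = P₁.append (Walk.cons h P₂) := by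
  induction P with
  | nil => simp at hd
  | @cons a b c h p ih =>
    obtain ⟨d, hd, hxy⟩ := hd
    rw [Walk.darts_cons, List.mem_cons] at hd
    rcases hd with rfl | hd
    · simp only [Prod.mk.injEq] at hxy
      obtain ⟨rfl, rfl⟩ := hxy
      exact ⟨Walk.nil, h, p, rfl⟩
    · obtain ⟨P₁, h', P₂, rfl⟩ := ih ⟨d, hd, hxy⟩
      exact ⟨Walk.cons h P₁, h', P₂, rfl⟩

/-- Two paths through the same dart, all other edges of which lie in an acyclic graph, agree. -/
theorem IsAcyclic.eq_of_dart {G T : SimpleGraph V} (hT : T.IsAcyclic) {u v x y : V}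
    {P Q : G.Walk u v} (hP : P.IsPath) (hQ : Q.IsPath)
    (hPT : ∀ e ∈ P.edges, e ∈ T.edgeSet ∨ e = s(x, y))
    (hQT : ∀ e ∈ Q.edges, e ∈ T.edgeSet ∨ e = s(x, y))
    (hPd : ∃ d ∈ P.darts, d.toProd = (x, y)) (hQd : ∃ d ∈ Q.darts, d.toProd = (x, y)) :
    P = Q := by
  -- A path uses the exceptional edge only once, so the pieces before and after it lie in `T` and
  -- are determined by their endpoints.
  have aux : ∀ {R : G.Walk u v} (_ : R.IsPath) (_ : ∀ e ∈ R.edges, e ∈ T.edgeSet ∨ e = s(x, y))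
      (R₁ : G.Walk u x) (h : G.Adj x y) (R₂ : G.Walk y v) (_ : R = R₁.append (Walk.cons h R₂)),
      (R₁.IsPath ∧ ∀ e ∈ R₁.edges, e ∈ T.edgeSet) ∧ (R₂.IsPath ∧ ∀ e ∈ R₂.edges, e ∈ T.edgeSet) := by
    rintro R hR hRT R₁ h R₂ rfl
    have hnd := hR.isTrail.edges_nodup
    rw [Walk.edges_append, Walk.edges_cons, List.nodup_append] at hnd
    obtain ⟨-, hnd2, hnd3⟩ := hnd
    rw [List.nodup_cons] at hnd2
    refine ⟨⟨hR.of_append_left, fun e he => ?_⟩, hR.of_append_right.of_cons, fun e he => ?_⟩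
    · refine (hRT e (by simp [he])).resolve_right ?_
      rintro rfl
      exact hnd3 _ he _ (by simp) rfl
    · refine (hRT e (by simp [he])).resolve_right ?_
      rintro rfl
      exact hnd2.1 he
  obtain ⟨P₁, h, P₂, hPe⟩ := P.exists_eq_append_cons hPd
  obtain ⟨Q₁, h', Q₂, hQe⟩ := Q.exists_eq_append_cons hQd
  obtain ⟨hP1, hP2⟩ := aux hP hPT P₁ h P₂ hPe
  obtain ⟨hQ1, hQ2⟩ := aux hQ hQT Q₁ h' Q₂ hQe
  rw [hPe, hQe, hT.eq_of_edges_subset hP1.1 hQ1.1 hP1.2 hQ1.2,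
    hT.eq_of_edges_subset hP2.1 hQ2.1 hP2.2 hQ2.2]

theorem Walk.exists_dart_of_mem_edges {G : SimpleGraph V} {u v x y : V} {P : G.Walk u v}
    (h : s(x, y) ∈ P.edges) :
    (∃ d ∈ P.darts, d.toProd = (x, y)) ∨ ∃ d ∈ P.darts, d.toProd = (y, x) := by
  obtain ⟨d, hd, he⟩ := List.mem_map.1 h
  rcases Sym2.eq_iff.1 (show s(d.toProd.1, d.toProd.2) = s(x, y) from he) with ⟨h1, h2⟩ | ⟨h1, h2⟩
  · exact Or.inl ⟨d, hd, Prod.ext h1 h2⟩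
  · exact Or.inr ⟨d, hd, Prod.ext h1 h2⟩

theorem edist_add_edist_le_of_mem_support {G : SimpleGraph V} {u v x : V} {P : G.Walk u v}
    (h : x ∈ P.support) : G.edist u x + G.edist x v ≤ P.length := by
  classical
  calc G.edist u x + G.edist x v
      ≤ ((P.takeUntil x h).length : ℕ∞) + (P.dropUntil x h).length :=
        add_le_add (edist_le _) (edist_le _)
    _ = P.length := by
        rw [← Nat.cast_add, ← Walk.length_append, Walk.take_spec]

/-- If all short paths between two vertices have their edges in an acyclic graph plus one edge, then
there are at most three of them. -/
theorem card_path_le_three [Finite V] {G T : SimpleGraph V} (hT : T.IsAcyclic) {j k x y : V} {ℓ : ℕ}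
    (hloc : ∀ p : G.Walk j k, p.IsPath → p.length ≤ ℓ →
      ∀ e ∈ p.edges, e ∈ T.edgeSet ∨ e = s(x, y)) :
    Nat.card {p : G.Walk j k // p.IsPath ∧ p.length = ℓ} ≤ 3 := by
  classical
  have hloc' : ∀ p : G.Walk j k, p.IsPath → p.length ≤ ℓ →
      ∀ e ∈ p.edges, e ∈ T.edgeSet ∨ e = s(y, x) := fun p h1 h2 e he => by
    rw [Sym2.eq_swap]; exact hloc p h1 h2 e he
  let f : {p : G.Walk j k // p.IsPath ∧ p.length = ℓ} → Fin 3 := fun p =>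
    if ∃ d ∈ p.1.darts, d.toProd = (x, y) then 0
    else if ∃ d ∈ p.1.darts, d.toProd = (y, x) then 1 else 2
  have hf : Function.Injective f := by
    rintro ⟨p, hp, hpl⟩ ⟨q, hq, hql⟩ hpq
    rw [Subtype.mk.injEq]
    simp only [f] at hpq
    have tree : ∀ r : G.Walk j k, r.IsPath → r.length = ℓ → (¬ ∃ d ∈ r.darts, d.toProd = (x, y)) →
        (¬ ∃ d ∈ r.darts, d.toProd = (y, x)) → ∀ e ∈ r.edges, e ∈ T.edgeSet := by
      intro r hr hrl h1 h2 e he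
      refine (hloc r hr hrl.le e he).resolve_right ?_
      rintro rfl
      exact (Walk.exists_dart_of_mem_edges he).elim h1 h2
    by_cases hp1 : ∃ d ∈ p.darts, d.toProd = (x, y) <;>
      by_cases hq1 : ∃ d ∈ q.darts, d.toProd = (x, y)
    · exact hT.eq_of_dart hp hq (hloc p hp hpl.le) (hloc q hq hql.le) hp1 hq1
    · rw [if_pos hp1, if_neg hq1] at hpq
      split_ifs at hpq <;> simp at hpq
    · rw [if_neg hp1, if_pos hq1] at hpq
      split_ifs at hpq <;> simp at hpq
    · rw [if_neg hp1, if_neg hq1] at hpq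
      by_cases hp2 : ∃ d ∈ p.darts, d.toProd = (y, x) <;>
        by_cases hq2 : ∃ d ∈ q.darts, d.toProd = (y, x)
      · exact hT.eq_of_dart hp hq (hloc' p hp hpl.le) (hloc' q hq hql.le) hp2 hq2
      · simp [if_pos hp2, if_neg hq2] at hpq
      · simp [if_neg hp2, if_pos hq2] at hpq
      · exact hT.eq_of_edges_subset hp hq (tree p hp hpl hp1 hp2) (tree q hq hql hq1 hq2)
  simpa using Nat.card_le_card_of_injective f hf

end SimpleGraph

/-! ### The deterministic bound on the spectral radius. -/

open SimpleGraph

/-- Apply the matrix twice to an eigenvector and read off a coordinate of maximal modulus. -/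
theorem Matrix.specRadius_sq_le {n : ℕ} (A : Matrix (Fin n) (Fin n) ℝ) {b : ℝ} (hb : 0 ≤ b)
    (h : ∀ i, ∑ j, ∑ k, |A i j| * |A j k| ≤ b ^ 2) : A.specRadius ≤ ENNReal.ofReal b := by
  unfold Matrix.specRadius spectralRadius
  refine iSup₂_le fun z hz => ?_
  set B : Matrix (Fin n) (Fin n) ℂ := A.map (fun x : ℝ => (x : ℂ)) with hB
  have hz' : z ∈ spectrum ℂ (Matrix.toLin' B) := by
    rwa [Matrix.spectrum_toLin']
  rw [← Module.End.hasEigenvalue_iff_mem_spectrum] at hz'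
  obtain ⟨v, hv⟩ := hz'.exists_hasEigenvector
  have hBv : B.mulVec v = z • v := by
    have := hv.apply_eq_smul
    rwa [Matrix.toLin'_apply] at this
  obtain ⟨i₀, hi₀⟩ : ∃ i, v i ≠ 0 := by
    by_contra! hcon
    exact hv.2 (funext hcon)
  obtain ⟨i, -, hi⟩ := Finset.univ.exists_max_image (fun i => ‖v i‖) ⟨i₀, Finset.mem_univ _⟩
  have hpos : 0 < ‖v i‖ := (norm_pos_iff.2 hi₀).trans_le (hi i₀ (Finset.mem_univ _))
  have e1 : ∀ i, z * v i = ∑ j, B i j * v j := fun i => by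
    have := congrFun hBv i
    simp only [Matrix.mulVec, dotProduct, Pi.smul_apply, smul_eq_mul] at this
    exact this.symm
  have e2 : z ^ 2 * v i = ∑ j, ∑ k, B i j * B j k * v k := by
    calc z ^ 2 * v i = z * ∑ j, B i j * v j := by rw [← e1]; ring
      _ = ∑ j, B i j * (z * v j) := by
        rw [Finset.mul_sum]; exact Finset.sum_congr rfl fun j _ => by ring
      _ = _ := by
        refine Finset.sum_congr rfl fun j _ => ?_
        rw [e1 j, Finset.mul_sum]; exact Finset.sum_congr rfl fun k _ => by ring
  have hBn : ∀ i j, ‖B i j‖ = |A i j| := fun i j => by simp [hB]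
  have e3 : ‖z‖ ^ 2 * ‖v i‖ ≤ b ^ 2 * ‖v i‖ := by
    calc ‖z‖ ^ 2 * ‖v i‖ = ‖z ^ 2 * v i‖ := by rw [norm_mul, norm_pow]
      _ ≤ ∑ j, ∑ k, |A i j| * |A j k| * ‖v i‖ := by
        rw [e2]
        refine (norm_sum_le _ _).trans (Finset.sum_le_sum fun j _ => (norm_sum_le _ _).trans
          (Finset.sum_le_sum fun k _ => ?_))
        rw [norm_mul, norm_mul, hBn, hBn]
        exact mul_le_mul_of_nonneg_left (hi k (Finset.mem_univ _)) (by positivity)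
      _ = (∑ j, ∑ k, |A i j| * |A j k|) * ‖v i‖ := by
        simp only [Finset.sum_mul]
      _ ≤ _ := mul_le_mul_of_nonneg_right (h i) hpos.le
  have e4 : ‖z‖ ≤ b := by
    have := le_of_mul_le_mul_right e3 hpos
    exact (pow_le_pow_iff_left₀ (norm_nonneg _) hb two_ne_zero).1 this
  change ‖z‖ₑ ≤ _
  rw [← ofReal_norm]
  exact ENNReal.ofReal_le_ofReal e4

open Classical in
/-- The number of vertices at distance `t` from `x`. -/
noncomputable def SimpleGraph.sphereCard {V : Type*} [Fintype V] (G : SimpleGraph V) (x : V)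
    (t : ℕ) : ℕ :=
  (Finset.univ.filter fun j => G.edist x j = t).card

-- Splitting by the two distances `b₁ + b₂ ≤ ℓ` gives at most `(ℓ+1)²` classes, and the growth
-- factors multiply to at most `a^ℓ`, not `a^(2ℓ)`.
open Classical in
theorem SimpleGraph.card_edist_add_edist_le {V : Type*} [Fintype V] (G : SimpleGraph V) (x : V)
    (ℓ : ℕ) {L a : ℝ} (ha : 1 ≤ a)
    (hs : ∀ t ≤ ℓ, (G.sphereCard x t : ℝ) ≤ L * (t + 1) * a ^ t) :
    ((Finset.univ.filter fun q : V × V => G.edist q.1 x + G.edist x q.2 ≤ ℓ).card : ℝ)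
      ≤ (L * (ℓ + 1) ^ 2) ^ 2 * a ^ ℓ := by
  let N : ℕ → Finset V := fun t => Finset.univ.filter fun j => G.edist x j = t
  let I := (Finset.range (ℓ + 1) ×ˢ Finset.range (ℓ + 1)).filter fun b => b.1 + b.2 ≤ ℓ
  have hsub : (Finset.univ.filter fun q : V × V => G.edist q.1 x + G.edist x q.2 ≤ ℓ) ⊆
      I.biUnion fun b => N b.1 ×ˢ N b.2 := by
    intro q hq
    rw [Finset.mem_filter, edist_comm] at hq
    have h1 : G.edist x q.1 ≠ ⊤ := by
      intro h; rw [h] at hq; simp at hq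
    have h2 : G.edist x q.2 ≠ ⊤ := by
      intro h; rw [h] at hq; simp at hq
    obtain ⟨b1, hb1⟩ := ENat.ne_top_iff_exists.1 h1
    obtain ⟨b2, hb2⟩ := ENat.ne_top_iff_exists.1 h2
    rw [← hb1, ← hb2] at hq
    have hq2 : b1 + b2 ≤ ℓ := by exact_mod_cast hq.2
    rw [Finset.mem_biUnion]
    refine ⟨(b1, b2), ?_, ?_⟩
    · simp only [I, Finset.mem_filter, Finset.mem_product, Finset.mem_range]
      omega
    · simp [N, hb1, hb2]
  have hL : 0 ≤ L := by
    have := hs 0 (Nat.zero_le _)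
    have h0 : (0 : ℝ) ≤ G.sphereCard x 0 := Nat.cast_nonneg _
    simp at this
    linarith
  have hterm : ∀ b ∈ I, (((N b.1 ×ˢ N b.2).card : ℕ) : ℝ) ≤ (L * (ℓ + 1)) ^ 2 * a ^ ℓ := by
    intro b hb
    simp only [I, Finset.mem_filter, Finset.mem_product, Finset.mem_range] at hb
    rw [Finset.card_product, Nat.cast_mul]
    have h1 := hs b.1 (by omega)
    have h2 := hs b.2 (by omega)
    have g1 : ((b.1 : ℝ) + 1) ≤ ℓ + 1 := by
      have : (b.1 : ℝ) ≤ ℓ := by exact_mod_cast (by omega : b.1 ≤ ℓ)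
      linarith
    have g2 : ((b.2 : ℝ) + 1) ≤ ℓ + 1 := by
      have : (b.2 : ℝ) ≤ ℓ := by exact_mod_cast (by omega : b.2 ≤ ℓ)
      linarith
    calc ((N b.1).card : ℝ) * (N b.2).card
        ≤ (L * (b.1 + 1) * a ^ b.1) * (L * (b.2 + 1) * a ^ b.2) :=
          mul_le_mul h1 h2 (Nat.cast_nonneg _) (by positivity)
      _ = L ^ 2 * ((b.1 + 1) * (b.2 + 1)) * a ^ (b.1 + b.2) := by rw [pow_add]; ring
      _ ≤ L ^ 2 * ((ℓ + 1) * (ℓ + 1)) * a ^ ℓ := by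
          have := pow_le_pow_right₀ ha hb.2
          gcongr
      _ = _ := by ring
  have hI : (I.card : ℝ) ≤ (ℓ + 1) ^ 2 := by
    have : I.card ≤ (ℓ + 1) * (ℓ + 1) := by
      refine (Finset.card_filter_le _ _).trans ?_
      simp
    calc (I.card : ℝ) ≤ ((ℓ + 1) * (ℓ + 1) : ℕ) := by exact_mod_cast this
      _ = _ := by push_cast; ring
  calc ((Finset.univ.filter fun q : V × V => G.edist q.1 x + G.edist x q.2 ≤ ℓ).card : ℝ)
      ≤ ((I.biUnion fun b => N b.1 ×ˢ N b.2).card : ℝ) := by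
        exact_mod_cast Finset.card_le_card hsub
    _ ≤ ∑ b ∈ I, (((N b.1 ×ˢ N b.2).card : ℕ) : ℝ) := by exact_mod_cast Finset.card_biUnion_le
    _ ≤ ∑ b ∈ I, (L * (ℓ + 1)) ^ 2 * a ^ ℓ := Finset.sum_le_sum hterm
    _ = I.card * ((L * (ℓ + 1)) ^ 2 * a ^ ℓ) := by rw [Finset.sum_const, nsmul_eq_mul]
    _ ≤ (ℓ + 1) ^ 2 * ((L * (ℓ + 1)) ^ 2 * a ^ ℓ) := by gcongr
    _ = _ := by ring

/-- All but at most one of the edges within distance `R` of `i` belong to the breadth-first search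
tree. -/
def SimpleGraph.AlmostTreeBall {V : Type*} (G : SimpleGraph V) (i : V) (R : ℕ) : Prop :=
  ∃ x y : V, ∀ u v, G.Adj u v → G.edist i u ≤ R → G.edist i v ≤ R →
    (G.bfsTree i).Adj u v ∨ s(u, v) = s(x, y)

/-- A walk of length at most `ℓ` starting within `m` of `i` never leaves the ball of radius `m + ℓ`.
Used with `m = 0` and `m = ℓ`, which is why balls of radius `2ℓ` are needed. -/
theorem SimpleGraph.edges_mem_of_ball {V : Type*} {G T : SimpleGraph V} {i x y : V} {R : ℕ}
    (h : ∀ u v, G.Adj u v → G.edist i u ≤ R → G.edist i v ≤ R → T.Adj u v ∨ s(u, v) = s(x, y))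
    {j k : V} {ℓ m : ℕ} (hj : G.edist i j ≤ m) (hR : m + ℓ ≤ R) (p : G.Walk j k)
    (hp : p.length ≤ ℓ) : ∀ e ∈ p.edges, e ∈ T.edgeSet ∨ e = s(x, y) := by
  intro e he
  have hball : ∀ w ∈ p.support, G.edist i w ≤ R := by
    intro w hw
    have h1 : G.edist j w ≤ p.length :=
      le_trans le_self_add (edist_add_edist_le_of_mem_support hw)
    calc G.edist i w ≤ G.edist i j + G.edist j w := G.edist_triangle
      _ ≤ m + p.length := add_le_add hj h1
      _ ≤ R := by exact_mod_cast (by omega : m + p.length ≤ R)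
  induction e with
  | h u v =>
    exact h u v (p.adj_of_mem_edges he) (hball u (p.fst_mem_support_of_mem_edges he))
      (hball v (p.snd_mem_support_of_mem_edges he))

theorem abs_path_sub_distance_le {n : ℕ} {G T : SimpleGraph (Fin n)} (hT : T.IsAcyclic)
    {j k x y : Fin n} {ℓ : ℕ}
    (hloc : ∀ p : G.Walk j k, p.IsPath → p.length ≤ ℓ →
      ∀ e ∈ p.edges, e ∈ T.edgeSet ∨ e = s(x, y)) :
    |(pathExpansionMatrix G ℓ - distanceMatrix G ℓ) j k| ≤ 3 := by
  have h1 : (pathExpansionMatrix G ℓ j k) ≤ 3 := by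
    simp only [pathExpansionMatrix, Matrix.of_apply]
    exact_mod_cast card_path_le_three hT hloc
  have h0 : 0 ≤ pathExpansionMatrix G ℓ j k := by
    simp [pathExpansionMatrix]
  have h2 : 0 ≤ distanceMatrix G ℓ j k ∧ distanceMatrix G ℓ j k ≤ 1 := by
    simp only [distanceMatrix, Matrix.of_apply]
    split_ifs <;> norm_num
  rw [Matrix.sub_apply, abs_le]
  constructor <;> linarith [h2.1, h2.2]

theorem exists_path_of_edist_le {n : ℕ} {G : SimpleGraph (Fin n)} {j k : Fin n} {ℓ : ℕ}
    (h : G.edist j k ≤ ℓ) : ∃ p : G.Walk j k, p.IsPath ∧ (p.length : ℕ∞) = G.edist j k := by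
  have hr : G.Reachable j k := by
    apply reachable_of_edist_ne_top
    intro h'
    rw [h'] at h
    simp at h
  obtain ⟨p, hp, hpl⟩ := hr.exists_path_of_dist
  exact ⟨p, hp, by rw [hpl, hr.coe_dist_eq_edist]⟩

/-- Otherwise no short path passes through `x`, so short paths avoid the edge `xy` and are unique.
The only candidate for a path of length `ℓ` is then the geodesic, and the two matrix entries agree.
-/
theorem edist_add_edist_le_of_entry_ne_zero {n : ℕ} {G T : SimpleGraph (Fin n)} (hT : T.IsAcyclic)
    {j k x y : Fin n} {ℓ : ℕ}
    (hloc : ∀ p : G.Walk j k, p.IsPath → p.length ≤ ℓ →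
      ∀ e ∈ p.edges, e ∈ T.edgeSet ∨ e = s(x, y))
    (hne : (pathExpansionMatrix G ℓ - distanceMatrix G ℓ) j k ≠ 0) :
    G.edist j x + G.edist x k ≤ ℓ := by
  by_contra hcon
  apply hne
  have htree : ∀ p : G.Walk j k, p.IsPath → p.length ≤ ℓ → ∀ e ∈ p.edges, e ∈ T.edgeSet := by
    intro p hp hpl e he
    refine (hloc p hp hpl e he).resolve_right ?_
    rintro rfl
    apply hcon
    exact (edist_add_edist_le_of_mem_support (p.fst_mem_support_of_mem_edges he)).trans
      (by exact_mod_cast hpl)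
  have huniq : ∀ p q : G.Walk j k, p.IsPath → p.length ≤ ℓ → q.IsPath → q.length ≤ ℓ → p = q :=
    fun p q hp hpl hq hql => hT.eq_of_edges_subset hp hq (htree p hp hpl) (htree q hq hql)
  rw [Matrix.sub_apply, sub_eq_zero]
  simp only [pathExpansionMatrix, distanceMatrix, Matrix.of_apply]
  split_ifs with h
  · obtain ⟨p, hp, hpl⟩ := exists_path_of_edist_le h.le
    have hpl' : p.length = ℓ := by
      rw [h] at hpl; exact_mod_cast hpl
    have : Nat.card {p : G.Walk j k // p.IsPath ∧ p.length = ℓ} = 1 := by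
      rw [Nat.card_eq_one_iff_exists]
      exact ⟨⟨p, hp, hpl'⟩, fun q => Subtype.ext
        (huniq _ _ q.2.1 q.2.2.le hp hpl'.le)⟩
    rw [this, Nat.cast_one]
  · have : IsEmpty {p : G.Walk j k // p.IsPath ∧ p.length = ℓ} := by
      refine ⟨fun q => h ?_⟩
      obtain ⟨q, hq, hql⟩ := q
      have hle : G.edist j k ≤ ℓ := hql ▸ edist_le q
      obtain ⟨p, hp, hpl⟩ := exists_path_of_edist_le hle
      have hpl' : p.length ≤ ℓ := by
        rw [← hpl] at hle; exact_mod_cast hle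
      rw [← hpl, huniq p q hp hpl' hq hql.le, hql]
    simp

open Classical in
theorem specRadius_path_sub_distance_le {n : ℕ} {G : SimpleGraph (Fin n)} {ℓ : ℕ} {L a : ℝ}
    (ha : 1 ≤ a) (hL : 0 ≤ L)
    (hs : ∀ x, ∀ t ≤ ℓ, (G.sphereCard x t : ℝ) ≤ L * (t + 1) * a ^ t)
    (hb : ∀ i, G.AlmostTreeBall i (2 * ℓ)) :
    (pathExpansionMatrix G ℓ - distanceMatrix G ℓ).specRadius
      ≤ ENNReal.ofReal (3 * L * (ℓ + 1) ^ 2 * a ^ ((ℓ : ℝ) / 2)) := by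
  have ha0 : 0 ≤ a := by linarith
  apply Matrix.specRadius_sq_le _ (by positivity)
  intro i
  set A := pathExpansionMatrix G ℓ - distanceMatrix G ℓ with hA
  obtain ⟨x, y, hxy⟩ := hb i
  have hT := G.isAcyclic_bfsTree i
  have hloc0 : ∀ j, ∀ p : G.Walk i j, p.IsPath → p.length ≤ ℓ →
      ∀ e ∈ p.edges, e ∈ (G.bfsTree i).edgeSet ∨ e = s(x, y) := fun j p _ hp =>
    edges_mem_of_ball (m := 0) hxy (by simp) (by omega) p hp
  -- A nonzero `A i j` places `j` within `ℓ` of `i`, so the second path is governed by the same tree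
  -- and the same edge `xy`.
  have hloc1 : ∀ j, A i j ≠ 0 → ∀ k, ∀ p : G.Walk j k, p.IsPath → p.length ≤ ℓ →
      ∀ e ∈ p.edges, e ∈ (G.bfsTree i).edgeSet ∨ e = s(x, y) := by
    intro j hj k p _ hp
    have h1 := edist_add_edist_le_of_entry_ne_zero hT (hloc0 j) hj
    exact edges_mem_of_ball (m := ℓ) hxy (G.edist_triangle.trans h1) (by omega) p hp
  have hterm : ∀ j k, |A i j| * |A j k| ≤
      if G.edist j x + G.edist x k ≤ ℓ then (9 : ℝ) else 0 := by
    intro j k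
    by_cases hj : A i j = 0
    · rw [hj]; split_ifs <;> simp
    by_cases hk : A j k = 0
    · rw [hk]; split_ifs <;> simp
    rw [if_pos (edist_add_edist_le_of_entry_ne_zero hT (hloc1 j hj k) hk)]
    calc |A i j| * |A j k| ≤ 3 * 3 :=
          mul_le_mul (abs_path_sub_distance_le hT (hloc0 j))
            (abs_path_sub_distance_le hT (hloc1 j hj k)) (abs_nonneg _) (by norm_num)
      _ = 9 := by norm_num
  have hpow : (a ^ ((ℓ : ℝ) / 2)) ^ 2 = a ^ ℓ := by
    rw [← Real.rpow_natCast, ← Real.rpow_mul ha0, ← Real.rpow_natCast a ℓ]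
    congr 1
    push_cast
    ring
  calc ∑ j, ∑ k, |A i j| * |A j k|
      ≤ ∑ j, ∑ k, if G.edist j x + G.edist x k ≤ ℓ then (9 : ℝ) else 0 :=
        Finset.sum_le_sum fun j _ => Finset.sum_le_sum fun k _ => hterm j k
    _ = ((Finset.univ.filter fun q : Fin n × Fin n =>
          G.edist q.1 x + G.edist x q.2 ≤ ℓ).card : ℝ) * 9 := by
        rw [← Fintype.sum_prod_type'
          (f := fun j k => if G.edist j x + G.edist x k ≤ ℓ then (9 : ℝ) else 0),
          ← Finset.sum_filter, Finset.sum_const, nsmul_eq_mul]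
    _ ≤ ((L * (ℓ + 1) ^ 2) ^ 2 * a ^ ℓ) * 9 := by
        gcongr
        exact G.card_edist_add_edist_le x ℓ ha (hs x)
    _ = (3 * L * (ℓ + 1) ^ 2 * a ^ ((ℓ : ℝ) / 2)) ^ 2 := by
        rw [mul_pow _ (a ^ ((ℓ : ℝ) / 2)), hpow]; ring

/-! ### Independent edge indicators. -/

/-- The law of independent `Bool`-valued variables, the `e`-th of which is `true` with probability
`p e`. -/
noncomputable def bernoulliProd {ι : Type*} [Fintype ι] (p : ι → unitInterval) :
    Measure (ι → Bool) :=
  Measure.pi fun e => bernoulliMeasure true false (p e)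

instance {ι : Type*} [Fintype ι] (p : ι → unitInterval) :
    IsProbabilityMeasure (bernoulliProd p) := by
  unfold bernoulliProd; infer_instance

section BernoulliProd

variable {ι : Type*} [Fintype ι] [DecidableEq ι]

theorem bernoulliProd_real_forall_eq_true (p : ι → unitInterval) (E : Finset ι) :
    (bernoulliProd p).real {ω | ∀ e ∈ E, ω e = true} = ∏ e ∈ E, (p e : ℝ) := by
  have h : {ω : ι → Bool | ∀ e ∈ E, ω e = true} =
      Set.univ.pi fun e => if e ∈ E then {true} else Set.univ := by
    ext ω
    simp only [Set.mem_ofPred_eq, Set.mem_univ_pi]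
    refine forall_congr' fun e => ?_
    by_cases he : e ∈ E <;> simp [he]
  rw [h, measureReal_def, bernoulliProd, Measure.pi_pi, ENNReal.toReal_prod,
    ← Finset.prod_subset (Finset.subset_univ E)]
  · refine Finset.prod_congr rfl fun e he => ?_
    rw [if_pos he, ← measureReal_def]
    simp
  · intro e _ he
    rw [if_neg he]
    simp

theorem integral_mul_of_disjoint (p : ι → unitInterval) {S T : Finset ι} (hST : Disjoint S T)
    {f g : (ι → Bool) → ℝ} (hf : ∀ ω ω', (∀ e ∈ S, ω e = ω' e) → f ω = f ω')
    (hg : ∀ ω ω', (∀ e ∈ T, ω e = ω' e) → g ω = g ω') :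
    ∫ ω, f ω * g ω ∂bernoulliProd p = (∫ ω, f ω ∂bernoulliProd p) * ∫ ω, g ω ∂bernoulliProd p := by
  have hind : iIndepFun (fun (e : ι) (ω : ι → Bool) => ω e) (bernoulliProd p) :=
    iIndepFun_pi (X := fun _ b => b) fun e => aemeasurable_id
  have h := hind.indepFun_finset S T hST fun e => measurable_pi_apply e
  -- Coordinates outside `R` get the arbitrary value `false`, which `f` and `g` do not see; this
  -- presents them as functions of the restricted families.
  let ext : (R : Finset ι) → (R → Bool) → ι → Bool :=
    fun R y e => if he : e ∈ R then y ⟨e, he⟩ else false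
  have h2 := h.comp (φ := fun y => f (ext S y)) (ψ := fun y => g (ext T y))
    Measurable.of_discrete Measurable.of_discrete
  have hfe : ((fun y => f (ext S y)) ∘ fun (ω : ι → Bool) (e : S) => ω e) = f := by
    funext ω
    exact hf _ _ fun e he => by simp [ext, he]
  have hge : ((fun y => g (ext T y)) ∘ fun (ω : ι → Bool) (e : T) => ω e) = g := by
    funext ω
    exact hg _ _ fun e he => by simp [ext, he]
  rw [hfe, hge] at h2
  exact h2.integral_mul_eq_mul_integral Measurable.of_discrete.aestronglyMeasurable
    Measurable.of_discrete.aestronglyMeasurable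

theorem integral_prod_exp_le (p : ι → unitInterval) (S : Finset ι) {θ : ℝ} :
    ∫ ω, ∏ e ∈ S, Real.exp (if ω e = true then θ else 0) ∂bernoulliProd p
      ≤ Real.exp ((∑ e ∈ S, (p e : ℝ)) * (Real.exp θ - 1)) := by
  let f : ι → Bool → ℝ := fun e b => if e ∈ S then Real.exp (if b = true then θ else 0) else 1
  have h1 : ∀ ω : ι → Bool, ∏ e ∈ S, Real.exp (if ω e = true then θ else 0) = ∏ e, f e (ω e) := by
    intro ω
    rw [← Finset.prod_subset (Finset.subset_univ S)]
    · exact Finset.prod_congr rfl fun e he => by simp [f, he]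
    · intro e _ he
      simp [f, he]
  simp_rw [h1]
  rw [bernoulliProd, integral_fintype_prod_eq_prod, ← Finset.prod_subset (Finset.subset_univ S),
    Finset.sum_mul, Real.exp_sum]
  · refine Finset.prod_le_prod (fun e he => integral_nonneg fun b => ?_) fun e he => ?_
    · simp only [f, if_pos he]; positivity
    · rw [integral_bernoulliMeasure]
      simp only [f, if_pos he]
      have := Real.add_one_le_exp ((p e : ℝ) * (Real.exp θ - 1))
      simp only [if_true, smul_eq_mul, Bool.false_eq_true, if_false, Real.exp_zero]
      linarith
  · intro e _ he
    simp [f, he]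

end BernoulliProd

theorem graphOf_adj {n : ℕ} (ω : Sym2 (Fin n) → Bool) (u v : Fin n) :
    (graphOf ω).Adj u v ↔ ω s(u, v) = true ∧ u ≠ v := by
  simp [graphOf]

/-! ### Exponential tails for sphere sizes. -/

section Exploration

variable {n : ℕ}

/-- The vertices of `U` that are joined to some vertex of `F`. -/
def nbrsIn (ω : Sym2 (Fin n) → Bool) (F U : Finset (Fin n)) : Finset (Fin n) :=
  U.filter fun u => ∃ f ∈ F, ω s(f, u) = true

/-- The `t`-th layer of the exploration started from `F`, with unexplored vertices `U`. -/
def layer (ω : Sym2 (Fin n) → Bool) : ℕ → Finset (Fin n) → Finset (Fin n) → Finset (Fin n)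
  | 0, F, _ => F
  | t + 1, F, U => layer ω t (nbrsIn ω F U) (U \ nbrsIn ω F U)

open SimpleGraph in
theorem layer_eq_sphere (ω : Sym2 (Fin n) → Bool) (x : Fin n) (t : ℕ) :
    ∀ (s : ℕ) (F U : Finset (Fin n)), (∀ v, v ∈ F ↔ (graphOf ω).edist x v = s) →
      (∀ v, v ∈ U ↔ (s : ℕ∞) < (graphOf ω).edist x v) →
      ∀ v, v ∈ layer ω t F U ↔ (graphOf ω).edist x v = (s + t : ℕ) := by
  induction t with
  | zero => intro s F U hF _ v; exact hF v
  | succ t ih =>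
    intro s F U hF hU v
    have hN : ∀ v, v ∈ nbrsIn ω F U ↔ (graphOf ω).edist x v = (s + 1 : ℕ) := by
      intro v
      rw [nbrsIn, Finset.mem_filter, hU]
      constructor
      · rintro ⟨h1, f, hf, hfv⟩
        rw [hF] at hf
        apply le_antisymm
        · by_cases hfe : f = v
          · rw [← hfe, hf]; exact_mod_cast Nat.le_succ s
          · have hadj : (graphOf ω).Adj f v := (graphOf_adj ω f v).2 ⟨hfv, hfe⟩
            calc (graphOf ω).edist x v ≤ (graphOf ω).edist x f + (graphOf ω).edist f v :=
                  (graphOf ω).edist_triangle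
              _ = (s + 1 : ℕ) := by rw [hf, edist_eq_one_iff_adj.2 hadj]; norm_cast
        · push_cast
          exact Order.add_one_le_of_lt h1
      · intro h
        have hr : (graphOf ω).Reachable x v := by
          apply reachable_of_edist_ne_top
          rw [h]; exact ENat.natCast_ne_top _
        have hd : (graphOf ω).dist x v = s + 1 := by
          have := hr.coe_dist_eq_edist
          rw [h] at this; exact_mod_cast this
        have hne : x ≠ v := by
          rintro rfl
          simp at hd
        obtain ⟨u, hu, hud⟩ := exists_adj_dist_succ hr hne
        refine ⟨by rw [h]; exact_mod_cast Nat.lt_succ_self s, u, ?_, ((graphOf_adj ω u v).1 hu).1⟩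
        rw [hF, ← (hr.trans hu.symm.reachable).coe_dist_eq_edist]
        exact_mod_cast (by omega : (graphOf ω).dist x u = s)
    have := ih (s + 1) (nbrsIn ω F U) (U \ nbrsIn ω F U) hN (fun v => by
      rw [Finset.mem_sdiff, hN, hU]
      constructor
      · rintro ⟨h1, h2⟩
        refine lt_of_le_of_ne ?_ (Ne.symm h2)
        push_cast
        exact Order.add_one_le_of_lt h1
      · intro h
        exact ⟨lt_of_le_of_lt (by exact_mod_cast Nat.le_succ s) h, h.ne'⟩) v
    rw [layer, this, Nat.add_assoc, Nat.add_comm 1 t]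

theorem sphereCard_eq_card_layer (ω : Sym2 (Fin n) → Bool) (x : Fin n) (t : ℕ) :
    (graphOf ω).sphereCard x t = (layer ω t {x} (Finset.univ \ {x})).card := by
  classical
  rw [SimpleGraph.sphereCard]
  congr 1
  ext v
  rw [layer_eq_sphere ω x t 0, Finset.mem_filter, zero_add]
  · simp
  · intro v
    rw [Finset.mem_singleton, Nat.cast_zero, SimpleGraph.edist_eq_zero_iff, eq_comm]
  · intro v
    rw [Nat.cast_zero, pos_iff_ne_zero, Ne, SimpleGraph.edist_eq_zero_iff, eq_comm]
    simp

theorem nbrsIn_subset (ω : Sym2 (Fin n) → Bool) (F U : Finset (Fin n)) : nbrsIn ω F U ⊆ U :=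
  Finset.filter_subset _ _

theorem nbrsIn_congr {ω ω' : Sym2 (Fin n) → Bool} {F U : Finset (Fin n)}
    (h : ∀ f ∈ F, ∀ u ∈ U, ω s(f, u) = ω' s(f, u)) : nbrsIn ω F U = nbrsIn ω' F U := by
  refine Finset.filter_congr fun u hu => ?_
  exact exists_congr fun f => and_congr_right fun hf => by rw [h f hf u hu]

/-- With `disjoint_pairsBetween`, this makes the later layers independent of the edges that reveal
the first one. -/
theorem layer_congr {ω ω' : Sym2 (Fin n) → Bool} {U₀ : Finset (Fin n)}
    (h : ∀ e ∈ U₀.sym2, ω e = ω' e) (t : ℕ) :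
    ∀ {F U : Finset (Fin n)}, F ⊆ U₀ → U ⊆ U₀ → layer ω t F U = layer ω' t F U := by
  induction t with
  | zero => intros; rfl
  | succ t ih =>
    intro F U hF hU
    have hN : nbrsIn ω F U = nbrsIn ω' F U := nbrsIn_congr fun f hf u hu =>
      h _ (by simp [hF hf, hU hu])
    rw [layer, layer, ← hN]
    exact ih ((nbrsIn_subset _ _ _).trans hU) (Finset.sdiff_subset.trans hU)

/-- The pairs with one vertex in `F` and one in `U`. -/
def pairsBetween (F U : Finset (Fin n)) : Finset (Sym2 (Fin n)) :=
  (F ×ˢ U).image fun q => s(q.1, q.2)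

theorem injOn_pairs {F U : Finset (Fin n)} (hFU : Disjoint F U) :
    Set.InjOn (fun q : Fin n × Fin n => s(q.1, q.2)) (F ×ˢ U : Finset (Fin n × Fin n)) := by
  rintro ⟨f, u⟩ hq ⟨f', u'⟩ hq' h
  rw [Finset.mem_coe, Finset.mem_product] at hq hq'
  rcases Sym2.eq_iff.1 h with ⟨h1, h2⟩ | ⟨h1, h2⟩
  · exact Prod.ext h1 h2
  · exact absurd (h1 ▸ hq'.2) (Finset.disjoint_left.1 hFU hq.1)

theorem disjoint_pairsBetween {F U : Finset (Fin n)} (hFU : Disjoint F U) :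
    Disjoint (pairsBetween F U) U.sym2 := by
  rw [Finset.disjoint_left]
  intro e he he'
  obtain ⟨⟨f, u⟩, hq, rfl⟩ := Finset.mem_image.1 he
  rw [Finset.mem_product] at hq
  simp only [Finset.mk_mem_sym2_iff] at he'
  exact Finset.disjoint_left.1 hFU hq.1 he'.1

variable (p : Sym2 (Fin n) → unitInterval) {a : ℝ}

theorem integral_exp_nbrsIn_le (hp : ∀ u, ∑ v, (p s(u, v) : ℝ) ≤ a) {F U : Finset (Fin n)}
    (hFU : Disjoint F U) {θ : ℝ} (hθ : 0 ≤ θ) :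
    ∫ ω, Real.exp (θ * (nbrsIn ω F U).card) ∂bernoulliProd p
      ≤ Real.exp (F.card * a * (Real.exp θ - 1)) := by
  have hpt : ∀ ω : Sym2 (Fin n) → Bool, Real.exp (θ * (nbrsIn ω F U).card) ≤
      ∏ e ∈ pairsBetween F U, Real.exp (if ω e = true then θ else 0) := by
    intro ω
    rw [← Real.exp_sum]
    apply Real.exp_le_exp.2
    rw [pairsBetween, Finset.sum_image (injOn_pairs hFU), Finset.sum_product_right, nbrsIn,
      Finset.card_filter]
    push_cast
    rw [Finset.mul_sum]
    refine Finset.sum_le_sum fun u _ => ?_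
    split_ifs with h
    · obtain ⟨f, hf, hfu⟩ := h
      calc θ * 1 = if ω s(f, u) = true then θ else 0 := by rw [if_pos hfu, mul_one]
        _ ≤ _ := Finset.single_le_sum (f := fun f => if ω s(f, u) = true then θ else 0)
          (fun f _ => by positivity) hf
    · rw [mul_zero]
      exact Finset.sum_nonneg fun f _ => by positivity
  have hsum : ∑ e ∈ pairsBetween F U, (p e : ℝ) ≤ F.card * a := by
    rw [pairsBetween, Finset.sum_image (injOn_pairs hFU), Finset.sum_product, ← nsmul_eq_mul]
    refine Finset.sum_le_card_nsmul _ _ _ fun f _ => le_trans ?_ (hp f)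
    exact Finset.sum_le_sum_of_subset_of_nonneg (Finset.subset_univ U) fun v _ _ => (p _).2.1
  refine (integral_mono Integrable.of_finite Integrable.of_finite hpt).trans
    ((integral_prod_exp_le p _).trans (Real.exp_le_exp.2 ?_))
  exact mul_le_mul_of_nonneg_right hsum (by linarith [Real.add_one_le_exp θ])

/-- This dictates the recursion `y ↦ a y + 1`: the extra 1 absorbs the convexity of the exponential,
so one generation turns the rate `1/(a y + 1)` into `1/y`. -/
theorem exp_inv_add_one_sub_one_le {z : ℝ} (hz : 0 < z) : Real.exp (1 / (z + 1)) - 1 ≤ 1 / z := by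
  have h1 : 1 - 1 / (z + 1) = z / (z + 1) := by field_simp; ring
  have h2 : z / (z + 1) ≤ Real.exp (-(1 / (z + 1))) := by
    rw [← h1]
    linarith [Real.add_one_le_exp (-(1 / (z + 1)))]
  rw [Real.exp_neg] at h2
  have h3 := inv_anti₀ (by positivity) h2
  rw [inv_inv, inv_div] at h3
  have h4 : (z + 1) / z = 1 + 1 / z := by field_simp
  linarith

/-- Condition on the first layer `A`: given it, the rest is an exploration from `A` that reads only
pairs inside `U`, so the induction hypothesis applies with `y' = a y + 1`. Averaging `exp (|A| /
y')` then costs one Bernoulli moment bound. -/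
theorem integral_exp_layer_le (ha : 0 < a) (hp : ∀ u, ∑ v, (p s(u, v) : ℝ) ≤ a) (t : ℕ) :
    ∀ {y : ℝ} (_ : 0 < y) {F U : Finset (Fin n)} (_ : Disjoint F U),
      ∫ ω, Real.exp ((layer ω t F U).card / (fun z => a * z + 1)^[t] y) ∂bernoulliProd p
        ≤ Real.exp (F.card / y) := by
  induction t with
  | zero =>
    intro y _ F U _
    simp [layer]
  | succ t ih =>
    intro y hy F U hFU
    rw [Function.iterate_succ_apply]
    set y' := a * y + 1 with hy'
    have hay : 0 < a * y := mul_pos ha hy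
    have hy'0 : 0 < y' := by linarith
    set h := (fun z => a * z + 1)^[t] y' with hh
    let I : Finset (Fin n) → (Sym2 (Fin n) → Bool) → ℝ := fun A ω =>
      if nbrsIn ω F U = A then 1 else 0
    let g : Finset (Fin n) → (Sym2 (Fin n) → Bool) → ℝ := fun A ω =>
      Real.exp ((layer ω t A (U \ A)).card / h)
    have hdec : ∀ φ : Finset (Fin n) → (Sym2 (Fin n) → Bool) → ℝ, ∀ ω,
        φ (nbrsIn ω F U) ω = ∑ A ∈ U.powerset, I A ω * φ A ω := by
      intro φ ω
      rw [Finset.sum_eq_single_of_mem (nbrsIn ω F U)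
        (Finset.mem_powerset.2 (nbrsIn_subset _ _ _))]
      · simp [I]
      · intro A _ hA
        simp [I, hA.symm]
    have hind : ∀ A ∈ U.powerset, ∫ ω, I A ω * g A ω ∂bernoulliProd p =
        (∫ ω, I A ω ∂bernoulliProd p) * ∫ ω, g A ω ∂bernoulliProd p := by
      intro A hA
      rw [Finset.mem_powerset] at hA
      refine integral_mul_of_disjoint p (disjoint_pairsBetween hFU) ?_ ?_
      · intro ω ω' hω
        simp only [I]
        rw [nbrsIn_congr fun f hf u hu => hω _ (Finset.mem_image.2
          ⟨(f, u), Finset.mem_product.2 ⟨hf, hu⟩, rfl⟩)]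
      · intro ω ω' hω
        simp only [g]
        rw [layer_congr hω t hA Finset.sdiff_subset]
    calc ∫ ω, Real.exp ((layer ω (t + 1) F U).card / h) ∂bernoulliProd p
        = ∫ ω, ∑ A ∈ U.powerset, I A ω * g A ω ∂bernoulliProd p := by
          refine integral_congr_ae (Eventually.of_forall fun ω => ?_)
          exact hdec g ω
      _ = ∑ A ∈ U.powerset, (∫ ω, I A ω ∂bernoulliProd p) * ∫ ω, g A ω ∂bernoulliProd p := by
          rw [integral_finsetSum _ fun A _ => Integrable.of_finite]
          exact Finset.sum_congr rfl hind
      _ ≤ ∑ A ∈ U.powerset, (∫ ω, I A ω ∂bernoulliProd p) * Real.exp (A.card / y') := by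
          refine Finset.sum_le_sum fun A _ => mul_le_mul_of_nonneg_left ?_ ?_
          · exact ih hy'0 Finset.disjoint_sdiff
          · exact integral_nonneg fun ω => by simp only [I]; positivity
      _ = ∫ ω, Real.exp (1 / y' * (nbrsIn ω F U).card) ∂bernoulliProd p := by
          simp_rw [← integral_mul_const]
          rw [← integral_finsetSum _ fun A _ => Integrable.of_finite]
          refine integral_congr_ae (Eventually.of_forall fun ω => ?_)
          have := hdec (fun A _ => Real.exp (A.card / y')) ω
          simp only at this ⊢
          rw [← this]
          congr 1
          ring
      _ ≤ Real.exp (F.card * a * (Real.exp (1 / y') - 1)) :=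
          integral_exp_nbrsIn_le p hp hFU (by positivity)
      _ ≤ Real.exp (F.card / y) := by
          apply Real.exp_le_exp.2
          calc F.card * a * (Real.exp (1 / y') - 1) ≤ F.card * a * (1 / (a * y)) :=
                mul_le_mul_of_nonneg_left (exp_inv_add_one_sub_one_le hay) (by positivity)
            _ = F.card / y := by field_simp

theorem iterate_affine_le (ha : 1 ≤ a) (t : ℕ) :
    0 < (fun z => a * z + 1)^[t] 1 ∧ (fun z => a * z + 1)^[t] 1 ≤ (t + 1) * a ^ t := by
  induction t with
  | zero => simp
  | succ t ih =>
    rw [Function.iterate_succ_apply']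
    refine ⟨by have := ih.1; positivity, ?_⟩
    have h1 : (1 : ℝ) ≤ a ^ (t + 1) := one_le_pow₀ ha
    calc a * (fun z => a * z + 1)^[t] 1 + 1 ≤ a * ((t + 1) * a ^ t) + a ^ (t + 1) := by
          gcongr
          exact ih.2
      _ = _ := by push_cast; ring

/-- Markov's inequality for the exponential moment started from one vertex with `y = 1`, whose value
is at most `exp 1`. -/
theorem real_sphereCard_gt_le (ha : 1 ≤ a) (hp : ∀ u, ∑ v, (p s(u, v) : ℝ) ≤ a) {L : ℝ}
    (hL : 0 ≤ L) (x : Fin n) (t : ℕ) :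
    (bernoulliProd p).real {ω | L * (t + 1) * a ^ t < (graphOf ω).sphereCard x t}
      ≤ Real.exp (1 - L) := by
  have ha0 : 0 < a := by linarith
  obtain ⟨h1, h2⟩ := iterate_affine_le ha t
  set h := (fun z => a * z + 1)^[t] 1
  have hint := integral_exp_layer_le p ha0 hp t one_pos
    (F := {x}) (U := Finset.univ \ {x}) Finset.disjoint_sdiff
  have hmk := mul_meas_ge_le_integral_of_nonneg (μ := bernoulliProd p)
    (f := fun ω => Real.exp ((layer ω t {x} (Finset.univ \ {x})).card / h))
    (Eventually.of_forall fun ω => (Real.exp_pos _).le) Integrable.of_finite (Real.exp L)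
  have hsub : {ω | L * (t + 1) * a ^ t < ((graphOf ω).sphereCard x t : ℝ)} ⊆
      {ω | Real.exp L ≤ Real.exp ((layer ω t {x} (Finset.univ \ {x})).card / h)} := by
    intro ω hω
    rw [Set.mem_ofPred_eq, sphereCard_eq_card_layer] at hω
    rw [Set.mem_ofPred_eq, Real.exp_le_exp, le_div_iff₀ h1]
    calc L * h ≤ L * ((t + 1) * a ^ t) := by gcongr
      _ = L * (t + 1) * a ^ t := by ring
      _ ≤ _ := hω.le
  have hle := (measureReal_mono (μ := bernoulliProd p) hsub)
  simp only [Finset.card_singleton, Nat.cast_one, div_one] at hint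
  have h3 := hmk.trans hint
  rw [Real.exp_sub, le_div_iff₀ (Real.exp_pos _)]
  calc _ ≤ _ := mul_le_mul_of_nonneg_right hle (Real.exp_pos L).le
    _ ≤ _ := by rw [mul_comm]; exact h3

end Exploration

/-! ### Balls with two extra edges are rare. -/

section Excess

variable {n : ℕ}

/-- The event that the open edges `E` on the vertex set `U` can be extended, following the
instructions of a list, to a set of open edges on whose vertex set there are two further open edges.
The instruction `true` adds a new vertex, joined to the current one, and moves there; the
instruction `false` moves to any vertex of the present vertex set. -/
def excessEvent : List Bool → Finset (Fin n) → Finset (Sym2 (Fin n)) → Fin n →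
    Set (Sym2 (Fin n) → Bool)
  | [], U, E, _ => {ω | (∀ e ∈ E, ω e = true) ∧
      ∃ q ∈ U.sym2 ×ˢ U.sym2, q.1 ≠ q.2 ∧ q.1 ∉ E ∧ q.2 ∉ E ∧ ω q.1 = true ∧ ω q.2 = true}
  | true :: P, U, E, h => ⋃ v ∈ Uᶜ, excessEvent P (insert v U) (insert s(h, v) E) v
  | false :: P, U, E, _ => ⋃ u ∈ U, excessEvent P U E u

variable (p : Sym2 (Fin n) → unitInterval) {a c : ℝ}

theorem card_sym2_le_sq {N : ℕ} {U : Finset (Fin n)} (hU : U.card ≤ N) :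
    U.sym2.card ≤ N ^ 2 := by
  rw [Finset.card_sym2, Nat.choose_two_right]
  apply Nat.div_le_of_le_mul
  rcases Nat.eq_zero_or_pos U.card with h | h
  · simp [h]
  · calc (U.card + 1) * (U.card + 1 - 1) ≤ (2 * U.card) * U.card := by
          gcongr
          · omega
          · omega
      _ ≤ (2 * N) * N := by gcongr
      _ = 2 * N ^ 2 := by ring

/-- Each instruction is a union bound. A new vertex brings a new edge, and summing its probability
costs a factor `a`; a jump costs the number `N` of available vertices. The final pair of further
edges has at most `N^4` positions, each costing `c²`. -/
theorem real_excessEvent_le (ha : 0 ≤ a) (hp : ∀ u, ∑ v, (p s(u, v) : ℝ) ≤ a)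
    (hc : ∀ e, (p e : ℝ) ≤ c) (N : ℕ) (P : List Bool) :
    ∀ (U : Finset (Fin n)) (E : Finset (Sym2 (Fin n))) (h : Fin n), h ∈ U →
      (∀ e ∈ E, e ∈ U.sym2) → U.card + P.count true ≤ N →
      (bernoulliProd p).real (excessEvent P U E h) ≤
        (∏ e ∈ E, (p e : ℝ)) * (a ^ P.count true * N ^ P.count false * (N ^ 4 * c ^ 2)) := by
  have hw : ∀ E : Finset (Sym2 (Fin n)), 0 ≤ ∏ e ∈ E, (p e : ℝ) := fun E =>
    Finset.prod_nonneg fun e _ => (p e).2.1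
  induction P with
  | nil =>
    intro U E h _ _ hN
    have hN' : U.card ≤ N := by simpa using hN
    classical
    let Q := (U.sym2 ×ˢ U.sym2).filter fun q => q.1 ≠ q.2 ∧ q.1 ∉ E ∧ q.2 ∉ E
    have hsub : excessEvent [] U E h ⊆
        ⋃ q ∈ Q, {ω | ∀ e ∈ insert q.1 (insert q.2 E), ω e = true} := by
      rintro ω ⟨h1, q, hq, hne, hq1, hq2, ho1, ho2⟩
      refine Set.mem_biUnion (x := q) ?_ ?_
      · exact Finset.mem_filter.2 ⟨hq, hne, hq1, hq2⟩
      · intro e he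
        rw [Finset.mem_insert, Finset.mem_insert] at he
        rcases he with rfl | rfl | he
        · exact ho1
        · exact ho2
        · exact h1 e he
    have hterm : ∀ q ∈ Q, (bernoulliProd p).real
        {ω | ∀ e ∈ insert q.1 (insert q.2 E), ω e = true} ≤ (∏ e ∈ E, (p e : ℝ)) * c ^ 2 := by
      intro q hq
      obtain ⟨-, hne, hq1, hq2⟩ := Finset.mem_filter.1 hq
      rw [bernoulliProd_real_forall_eq_true, Finset.prod_insert (by simp [hne, hq1]),
        Finset.prod_insert hq2, ← mul_assoc, mul_comm]
      refine mul_le_mul_of_nonneg_left ?_ (hw E)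
      rw [sq]
      exact mul_le_mul (hc _) (hc _) (p _).2.1 ((p q.1).2.1.trans (hc _))
    have hQ : (Q.card : ℝ) ≤ N ^ 4 := by
      have h1 : Q.card ≤ N ^ 2 * N ^ 2 := by
        refine (Finset.card_filter_le _ _).trans ?_
        rw [Finset.card_product]
        exact Nat.mul_le_mul (card_sym2_le_sq hN') (card_sym2_le_sq hN')
      calc (Q.card : ℝ) ≤ (N ^ 2 * N ^ 2 : ℕ) := by exact_mod_cast h1
        _ = N ^ 4 := by push_cast; ring
    calc (bernoulliProd p).real (excessEvent [] U E h)
        ≤ ∑ q ∈ Q, (bernoulliProd p).real {ω | ∀ e ∈ insert q.1 (insert q.2 E), ω e = true} :=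
          (measureReal_mono hsub (measure_ne_top _ _)).trans (measureReal_biUnion_finset_le _ _)
      _ ≤ ∑ q ∈ Q, (∏ e ∈ E, (p e : ℝ)) * c ^ 2 := Finset.sum_le_sum hterm
      _ = Q.card * ((∏ e ∈ E, (p e : ℝ)) * c ^ 2) := by rw [Finset.sum_const, nsmul_eq_mul]
      _ ≤ N ^ 4 * ((∏ e ∈ E, (p e : ℝ)) * c ^ 2) :=
          mul_le_mul_of_nonneg_right hQ (mul_nonneg (hw E) (sq_nonneg c))
      _ = _ := by simp; ring
  | cons b P ih =>
    intro U E h hh hE hN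
    cases b with
    | true =>
      have hN' : U.card + (P.count true + 1) ≤ N := by simpa using hN
      set C : ℝ := a ^ P.count true * N ^ P.count false * (N ^ 4 * c ^ 2) with hC
      have hC0 : 0 ≤ C := by positivity
      calc (bernoulliProd p).real (excessEvent (true :: P) U E h)
          ≤ ∑ v ∈ Uᶜ, (bernoulliProd p).real
              (excessEvent P (insert v U) (insert s(h, v) E) v) :=
            measureReal_biUnion_finset_le _ _
        _ ≤ ∑ v ∈ Uᶜ, (p s(h, v) : ℝ) * ((∏ e ∈ E, (p e : ℝ)) * C) := by
            refine Finset.sum_le_sum fun v hv => ?_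
            rw [Finset.mem_compl] at hv
            -- The edge to a vertex outside `U` is not in `E`, so its probability enters the product
            -- as a genuinely new factor.
            have hnot : s(h, v) ∉ E := fun hmem => by
              have := hE _ hmem
              rw [Finset.mk_mem_sym2_iff] at this
              exact hv this.2
            refine (ih (insert v U) (insert s(h, v) E) v (Finset.mem_insert_self _ _) ?_ ?_).trans
              ?_
            · intro e he
              rcases Finset.mem_insert.1 he with rfl | he
              · simp [hh]
              · exact Finset.sym2_mono (Finset.subset_insert _ _) (hE e he)
            · rw [Finset.card_insert_of_notMem hv]; omega
            · rw [Finset.prod_insert hnot, mul_assoc]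
        _ = (∑ v ∈ Uᶜ, (p s(h, v) : ℝ)) * ((∏ e ∈ E, (p e : ℝ)) * C) := by rw [Finset.sum_mul]
        _ ≤ a * ((∏ e ∈ E, (p e : ℝ)) * C) := by
            refine mul_le_mul_of_nonneg_right (le_trans ?_ (hp h)) (mul_nonneg (hw E) hC0)
            exact Finset.sum_le_sum_of_subset_of_nonneg (Finset.subset_univ _)
              fun v _ _ => (p _).2.1
        _ = _ := by simp [hC]; ring
    | false =>
      have hN' : U.card + P.count true ≤ N := by simpa using hN
      set C : ℝ := a ^ P.count true * N ^ P.count false * (N ^ 4 * c ^ 2) with hC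
      have hC0 : 0 ≤ C := by positivity
      have hUN : (U.card : ℝ) ≤ N := by exact_mod_cast (by omega : U.card ≤ N)
      calc (bernoulliProd p).real (excessEvent (false :: P) U E h)
          ≤ ∑ u ∈ U, (bernoulliProd p).real (excessEvent P U E u) :=
            measureReal_biUnion_finset_le _ _
        _ ≤ ∑ u ∈ U, (∏ e ∈ E, (p e : ℝ)) * C :=
            Finset.sum_le_sum fun u hu => ih U E u hu hE hN'
        _ = U.card * ((∏ e ∈ E, (p e : ℝ)) * C) := by rw [Finset.sum_const, nsmul_eq_mul]
        _ ≤ N * ((∏ e ∈ E, (p e : ℝ)) * C) :=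
            mul_le_mul_of_nonneg_right hUN (mul_nonneg (hw E) hC0)
        _ = _ := by simp [hC]; ring

/-- The instructions for adding a branch of length `k`. -/
def branchInstr (k : ℕ) : List Bool := false :: List.replicate k true

-- Follow parents from `x` back to `U`, which contains the root, and replay the way forwards: one
-- jump into `U`, then only new vertices. The distance bound on added vertices ensures that each
-- next vertex is indeed new. Keeping all edges in the tree guarantees that non-tree edges are never
-- consumed.
open SimpleGraph in
theorem exists_branch (ω : Sym2 (Fin n) → Bool) (i : Fin n) (m : ℕ) :
    ∀ x, (graphOf ω).Reachable i x → (graphOf ω).dist i x = m →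
    ∀ (U : Finset (Fin n)) (E : Finset (Sym2 (Fin n))), i ∈ U →
      (∀ e ∈ E, e ∈ ((graphOf ω).bfsTree i).edgeSet ∧ ω e = true) →
      ∃ k ≤ m, ∃ (U' : Finset (Fin n)) (E' : Finset (Sym2 (Fin n))), U ⊆ U' ∧ x ∈ U' ∧
        (∀ w ∈ U', w ∈ U ∨ (graphOf ω).dist i w ≤ m) ∧
        (∀ e ∈ E', e ∈ ((graphOf ω).bfsTree i).edgeSet ∧ ω e = true) ∧
        ∀ P h, ω ∈ excessEvent P U' E' x → ω ∈ excessEvent (branchInstr k ++ P) U E h := by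
  set G := graphOf ω with hG
  have base : ∀ x (m : ℕ) (U : Finset (Fin n)) (E : Finset (Sym2 (Fin n))), x ∈ U →
      (∀ e ∈ E, e ∈ (G.bfsTree i).edgeSet ∧ ω e = true) →
      ∃ k ≤ m, ∃ (U' : Finset (Fin n)) (E' : Finset (Sym2 (Fin n))), U ⊆ U' ∧ x ∈ U' ∧
        (∀ w ∈ U', w ∈ U ∨ G.dist i w ≤ m) ∧
        (∀ e ∈ E', e ∈ (G.bfsTree i).edgeSet ∧ ω e = true) ∧
        ∀ P h, ω ∈ excessEvent P U' E' x → ω ∈ excessEvent (branchInstr k ++ P) U E h := by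
    intro x m U E hx hE
    exact ⟨0, Nat.zero_le _, U, E, subset_rfl, hx, fun w hw => Or.inl hw, hE,
      fun P h hω => Set.mem_biUnion (x := x) (by exact hx) hω⟩
  induction m with
  | zero =>
    intro x hr hd U E hi hE
    obtain rfl := hr.dist_eq_zero_iff.1 hd
    exact base _ 0 U E hi hE
  | succ m ih =>
    intro x hr hd U E hi hE
    by_cases hxU : x ∈ U
    · exact base x _ U E hxU hE
    have hne : i ≠ x := fun h => hxU (h ▸ hi)
    obtain ⟨hadj, hdp⟩ := bfsParent_spec hr hne
    set y := G.bfsParent i x with hy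
    obtain ⟨k, hk, U', E', hU', hyU', hdU', hE', hstep⟩ :=
      ih y (hr.trans hadj.symm.reachable) (by omega) U E hi hE
    have hxU' : x ∉ U' := fun h => (hdU' x h).elim hxU fun h => by omega
    have hopen : ω s(y, x) = true := ((graphOf_adj ω y x).1 hadj).1
    refine ⟨k + 1, by omega, insert x U', insert s(y, x) E',
      hU'.trans (Finset.subset_insert _ _), Finset.mem_insert_self _ _, ?_, ?_, ?_⟩
    · intro w hw
      rcases Finset.mem_insert.1 hw with rfl | hw
      · exact Or.inr hd.le
      · exact (hdU' w hw).imp_right fun h => by omega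
    · intro e he
      rcases Finset.mem_insert.1 he with rfl | he
      · exact ⟨Or.inl ⟨hy.symm, hdp ▸ Nat.lt_succ_self _⟩, hopen⟩
      · exact hE' e he
    · intro P h hω
      have h1 : ω ∈ excessEvent (true :: P) U' E' y :=
        Set.mem_biUnion (x := x) (by simpa using hxU') hω
      have h2 := hstep (true :: P) h h1
      have h3 : branchInstr (k + 1) ++ P = branchInstr k ++ true :: P := by
        simp [branchInstr, List.replicate_succ']
      rw [h3]
      exact h2

/-- The instructions for adding four branches. -/
def fourBranches (k : Fin 4 → ℕ) : List Bool :=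
  branchInstr (k 0) ++ (branchInstr (k 1) ++ (branchInstr (k 2) ++ (branchInstr (k 3) ++ [])))

open SimpleGraph in
theorem exists_excessEvent_of_not_almostTreeBall (ω : Sym2 (Fin n) → Bool) (i : Fin n) (R : ℕ)
    (h : ¬ (graphOf ω).AlmostTreeBall i R) :
    ∃ k : Fin 4 → Fin (R + 1), ω ∈ excessEvent (fourBranches fun b => k b) {i} ∅ i := by
  set G := graphOf ω with hG
  have hex : ∀ x y, ∃ u v, G.Adj u v ∧ G.edist i u ≤ R ∧ G.edist i v ≤ R ∧
      ¬ (G.bfsTree i).Adj u v ∧ s(u, v) ≠ s(x, y) := by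
    intro x y
    by_contra! hcon
    refine h ⟨x, y, fun u v h1 h2 h3 => ?_⟩
    by_contra! hcon2
    exact hcon2.2 (hcon u v h1 h2 h3 hcon2.1)
  have hball : ∀ w, G.edist i w ≤ R → G.Reachable i w ∧ G.dist i w ≤ R := by
    intro w hw
    have hr : G.Reachable i w := by
      apply reachable_of_edist_ne_top
      intro h'
      rw [h'] at hw
      simp at hw
    refine ⟨hr, ?_⟩
    rw [← hr.coe_dist_eq_edist] at hw
    exact_mod_cast hw
  -- The first non-tree edge only has to differ from the degenerate pair `s(i, i)`, which is no
  -- restriction; the second must differ from the first.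
  obtain ⟨x, y, hxy, hx, hy, hxyT, -⟩ := hex i i
  obtain ⟨z, w, hzw, hz, hw, hzwT, hne⟩ := hex x y
  obtain ⟨k0, hk0, U0, E0, hU0, hx0, -, hE0, hs0⟩ := exists_branch ω i _ x (hball x hx).1 rfl
    {i} ∅ (by simp) (by simp)
  obtain ⟨k1, hk1, U1, E1, hU1, hx1, -, hE1, hs1⟩ := exists_branch ω i _ y (hball y hy).1 rfl
    U0 E0 (hU0 (by simp)) hE0
  obtain ⟨k2, hk2, U2, E2, hU2, hx2, -, hE2, hs2⟩ := exists_branch ω i _ z (hball z hz).1 rfl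
    U1 E1 (hU1 (hU0 (by simp))) hE1
  obtain ⟨k3, hk3, U3, E3, hU3, hx3, -, hE3, hs3⟩ := exists_branch ω i _ w (hball w hw).1 rfl
    U2 E2 (hU2 (hU1 (hU0 (by simp)))) hE2
  have b0 : (graphOf ω).dist i x ≤ R := (hball x hx).2
  have b1 : (graphOf ω).dist i y ≤ R := (hball y hy).2
  have b2 : (graphOf ω).dist i z ≤ R := (hball z hz).2
  have b3 : (graphOf ω).dist i w ≤ R := (hball w hw).2
  refine ⟨![⟨k0, by omega⟩, ⟨k1, by omega⟩, ⟨k2, by omega⟩, ⟨k3, by omega⟩], ?_⟩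
  refine hs0 _ _ (hs1 _ _ (hs2 _ _ (hs3 _ _ ⟨fun e he => (hE3 e he).2, (s(x, y), s(z, w)), ?_,
    hne.symm, ?_, ?_, ((graphOf_adj ω x y).1 hxy).1, ((graphOf_adj ω z w).1 hzw).1⟩)))
  · simp only [Finset.mem_product, Finset.mk_mem_sym2_iff]
    exact ⟨⟨hU3 (hU2 (hU1 hx0)), hU3 (hU2 hx1)⟩, hU3 hx2, hx3⟩
  · exact fun hmem => hxyT (hE3 _ hmem).1
  · exact fun hmem => hzwT (hE3 _ hmem).1

theorem real_not_almostTreeBall_le (ha : 1 ≤ a) (hp : ∀ u, ∑ v, (p s(u, v) : ℝ) ≤ a)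
    (hc : ∀ e, (p e : ℝ) ≤ c) (i : Fin n) (R : ℕ) :
    (bernoulliProd p).real {ω | ¬ (graphOf ω).AlmostTreeBall i R} ≤
      (4 * R + 1) ^ 12 * a ^ (4 * R) * c ^ 2 := by
  have hsub : {ω | ¬ (graphOf ω).AlmostTreeBall i R} ⊆
      ⋃ k ∈ (Finset.univ : Finset (Fin 4 → Fin (R + 1))),
        excessEvent (fourBranches fun b => k b) {i} ∅ i := by
    intro ω hω
    obtain ⟨k, hk⟩ := exists_excessEvent_of_not_almostTreeBall ω i R hω
    exact Set.mem_biUnion (x := k) (by simp) hk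
  have hterm : ∀ k ∈ (Finset.univ : Finset (Fin 4 → Fin (R + 1))),
      (bernoulliProd p).real (excessEvent (fourBranches fun b => k b) {i} ∅ i) ≤
        a ^ (4 * R) * (4 * R + 1 : ℕ) ^ 4 * ((4 * R + 1 : ℕ) ^ 4 * c ^ 2) := by
    intro k _
    have hct : (fourBranches fun b => (k b : ℕ)).count true = k 0 + (k 1 + (k 2 + k 3)) := by
      simp [fourBranches, branchInstr]
    have hcf : (fourBranches fun b => (k b : ℕ)).count false = 4 := by
      simp [fourBranches, branchInstr, List.count_replicate]
    have h0 := (k 0).2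
    have h1 := (k 1).2
    have h2 := (k 2).2
    have h3 := (k 3).2
    -- The root and four branches of at most `R` new vertices each.
    have := real_excessEvent_le p (by linarith : 0 ≤ a) hp hc (4 * R + 1)
      (fourBranches fun b => (k b : ℕ)) {i} ∅ i (by simp) (by simp)
      (by rw [hct, Finset.card_singleton]; omega)
    rw [Finset.prod_empty, one_mul, hcf] at this
    refine this.trans ?_
    have hpow : a ^ (fourBranches fun b => (k b : ℕ)).count true ≤ a ^ (4 * R) :=
      pow_le_pow_right₀ ha (by rw [hct]; omega)
    gcongr
  calc (bernoulliProd p).real {ω | ¬ (graphOf ω).AlmostTreeBall i R}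
      ≤ ∑ k : Fin 4 → Fin (R + 1),
          (bernoulliProd p).real (excessEvent (fourBranches fun b => k b) {i} ∅ i) :=
        (measureReal_mono hsub (measure_ne_top _ _)).trans (measureReal_biUnion_finset_le _ _)
    _ ≤ ∑ k : Fin 4 → Fin (R + 1),
          a ^ (4 * R) * (4 * R + 1 : ℕ) ^ 4 * ((4 * R + 1 : ℕ) ^ 4 * c ^ 2) :=
        Finset.sum_le_sum hterm
    _ = (R + 1) ^ 4 * (a ^ (4 * R) * (4 * R + 1 : ℕ) ^ 4 * ((4 * R + 1 : ℕ) ^ 4 * c ^ 2)) := by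
        rw [Finset.sum_const, nsmul_eq_mul, Finset.card_univ, Fintype.card_fun]
        simp
    _ ≤ (4 * R + 1) ^ 4 *
          (a ^ (4 * R) * (4 * R + 1 : ℕ) ^ 4 * ((4 * R + 1 : ℕ) ^ 4 * c ^ 2)) := by
        have : (R : ℝ) + 1 ≤ 4 * R + 1 := by linarith [(Nat.cast_nonneg R : (0 : ℝ) ≤ R)]
        have h1 : (1 : ℝ) ≤ a := ha
        gcongr
    _ = _ := by push_cast; ring

end Excess

/-- Union bound over vertices and radii for the failure of either deterministic condition; `8 * ℓ`
is `4 * R` at `R = 2 * ℓ`. -/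
theorem real_specRadius_gt_le {n : ℕ} (p : Sym2 (Fin n) → unitInterval) {a c : ℝ} (ha : 1 ≤ a)
    (hp : ∀ u, ∑ v, (p s(u, v) : ℝ) ≤ a) (hc : ∀ e, (p e : ℝ) ≤ c) (ℓ : ℕ) {L : ℝ} (hL : 0 ≤ L) :
    (bernoulliProd p).real {ω | ¬ (pathExpansionMatrix (graphOf ω) ℓ -
        distanceMatrix (graphOf ω) ℓ).specRadius ≤
          ENNReal.ofReal (3 * L * (ℓ + 1) ^ 2 * a ^ ((ℓ : ℝ) / 2))} ≤
      n * ((ℓ + 1) * Real.exp (1 - L)) + n * ((8 * ℓ + 1) ^ 12 * a ^ (8 * ℓ) * c ^ 2) := by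
  let B₁ : Fin n → Set (Sym2 (Fin n) → Bool) := fun x => ⋃ t ∈ Finset.range (ℓ + 1),
    {ω | L * (t + 1) * a ^ t < (graphOf ω).sphereCard x t}
  let B₂ : Fin n → Set (Sym2 (Fin n) → Bool) := fun i =>
    {ω | ¬ (graphOf ω).AlmostTreeBall i (2 * ℓ)}
  have hsub : {ω | ¬ (pathExpansionMatrix (graphOf ω) ℓ -
        distanceMatrix (graphOf ω) ℓ).specRadius ≤
          ENNReal.ofReal (3 * L * (ℓ + 1) ^ 2 * a ^ ((ℓ : ℝ) / 2))} ⊆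
      (⋃ x ∈ (Finset.univ : Finset (Fin n)), B₁ x) ∪
        ⋃ i ∈ (Finset.univ : Finset (Fin n)), B₂ i := by
    intro ω hω
    by_contra hcon
    rw [Set.mem_union, not_or] at hcon
    simp only [B₁, B₂, Finset.mem_univ, Set.iUnion_true, Set.mem_iUnion, Set.mem_ofPred_eq,
      not_exists, not_lt, not_not, Finset.mem_range] at hcon
    exact hω (specRadius_path_sub_distance_le ha hL
      (fun x t ht => hcon.1 x t (Nat.lt_succ_of_le ht)) hcon.2)
  have h1 : ∀ x, (bernoulliProd p).real (B₁ x) ≤ (ℓ + 1) * Real.exp (1 - L) := by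
    intro x
    calc (bernoulliProd p).real (B₁ x)
        ≤ ∑ t ∈ Finset.range (ℓ + 1), (bernoulliProd p).real
            {ω | L * (t + 1) * a ^ t < (graphOf ω).sphereCard x t} :=
          measureReal_biUnion_finset_le _ _
      _ ≤ ∑ t ∈ Finset.range (ℓ + 1), Real.exp (1 - L) :=
          Finset.sum_le_sum fun t _ => real_sphereCard_gt_le p ha hp hL x t
      _ = _ := by simp
  have h2 : ∀ i, (bernoulliProd p).real (B₂ i) ≤ (8 * ℓ + 1) ^ 12 * a ^ (8 * ℓ) * c ^ 2 := by
    intro i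
    have := real_not_almostTreeBall_le p ha hp hc i (2 * ℓ)
    have e1 : (4 * ((2 * ℓ : ℕ) : ℝ) + 1) = 8 * ℓ + 1 := by push_cast; ring
    have e2 : 4 * (2 * ℓ) = 8 * ℓ := by ring
    rwa [e1, e2] at this
  calc _ ≤ (bernoulliProd p).real (⋃ x ∈ (Finset.univ : Finset (Fin n)), B₁ x) +
        (bernoulliProd p).real (⋃ i ∈ (Finset.univ : Finset (Fin n)), B₂ i) :=
        (measureReal_mono hsub (measure_ne_top _ _)).trans (measureReal_union_le _ _)
    _ ≤ ∑ x : Fin n, (bernoulliProd p).real (B₁ x) + ∑ i : Fin n, (bernoulliProd p).real (B₂ i) :=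
        add_le_add (measureReal_biUnion_finset_le _ _) (measureReal_biUnion_finset_le _ _)
    _ ≤ ∑ x : Fin n, (ℓ + 1) * Real.exp (1 - L) +
          ∑ i : Fin n, (8 * ℓ + 1) ^ 12 * a ^ (8 * ℓ) * c ^ 2 :=
        add_le_add (Finset.sum_le_sum fun x _ => h1 x) (Finset.sum_le_sum fun i _ => h2 i)
    _ = _ := by simp

/-! ### Averaging over the random types. -/

namespace SBM

variable {r : ℕ} (S : SBM r)

/-- The sum of the entries of `W`, an upper bound of each entry. -/
noncomputable def totalWeight : ℝ := ∑ i, ∑ j, S.W i j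

theorem W_le_totalWeight (i j : Fin r) : S.W i j ≤ S.totalWeight :=
  (Finset.single_le_sum (f := fun j => S.W i j) (fun j _ => S.W_nonneg i j)
    (Finset.mem_univ j)).trans
    (Finset.single_le_sum (f := fun i => ∑ j, S.W i j)
      (fun i _ => Finset.sum_nonneg fun j _ => S.W_nonneg i j) (Finset.mem_univ i))

theorem integral_W_typePMF {α : ℝ} (hdeg : ∀ j, ∑ i, S.meanProgeny i j = α) (j : Fin r) :
    ∫ i, S.W i j ∂S.typePMF.toMeasure = α := by
  rw [PMF.integral_eq_sum, ← hdeg j]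
  refine Finset.sum_congr rfl fun i _ => ?_
  rw [meanProgeny, Matrix.diagonal_mul, typePMF, PMF.ofFintype_apply,
    ENNReal.toReal_ofReal (S.π_nonneg i), smul_eq_mul]

/-- The law of the types of `n` vertices. -/
noncomputable def typesLaw (n : ℕ) : Measure (Fin n → Fin r) :=
  Measure.pi fun _ : Fin n => S.typePMF.toMeasure

instance (n : ℕ) : IsProbabilityMeasure (S.typesLaw n) := by
  unfold typesLaw; infer_instance

/-- Chebyshev's inequality: the sum is over independent bounded terms of mean `α`, by the column-sum
condition. -/
theorem typesLaw_degree_ge_le {α : ℝ} (hα : 0 < α)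
    (hdeg : ∀ j, ∑ i, S.meanProgeny i j = α) {n : ℕ} (hn : 0 < n) {δ : ℝ} (hδ : 0 < δ)
    (j : Fin r) :
    S.typesLaw n {σ | n * (α * (1 + δ)) ≤ ∑ u, S.W (σ u) j} ≤
      ENNReal.ofReal (S.totalWeight ^ 2 / (n * (α * δ) ^ 2)) := by
  have hn' : (0 : ℝ) < n := by exact_mod_cast hn
  set X : (Fin n → Fin r) → ℝ := ∑ u, fun σ => S.W (σ u) j with hX
  have hXa : ∀ σ, X σ = ∑ u, S.W (σ u) j := fun σ => by simp [hX]
  have hmem : ∀ {Ω : Type} [MeasurableSpace Ω] [DiscreteMeasurableSpace Ω] [Finite Ω]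
      (ν : Measure Ω) [IsProbabilityMeasure ν] (f : Ω → ℝ), MemLp f 2 ν := by
    intro Ω _ _ _ ν _ f
    obtain ⟨C, hC⟩ := (Set.finite_range fun x => ‖f x‖).bddAbove
    exact MemLp.of_bound Measurable.of_discrete.aestronglyMeasurable C
      (Eventually.of_forall fun x => hC ⟨x, rfl⟩)
  have hmean : ∫ σ, X σ ∂S.typesLaw n = n * α := by
    simp_rw [hXa]
    rw [integral_finsetSum _ fun u _ => Integrable.of_finite]
    have : ∀ u : Fin n, ∫ σ, S.W (σ u) j ∂S.typesLaw n = α := by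
      intro u
      rw [typesLaw, integral_comp_eval (μ := fun _ : Fin n => S.typePMF.toMeasure)
        (f := fun i => S.W i j) (i := u) Measurable.of_discrete.aestronglyMeasurable,
        S.integral_W_typePMF hdeg]
    simp [this]
  have hvar : Var[X; S.typesLaw n] ≤ n * S.totalWeight ^ 2 := by
    calc Var[X; S.typesLaw n] = ∑ u : Fin n, Var[fun i => S.W i j; S.typePMF.toMeasure] :=
          variance_sum_pi (μ := fun _ : Fin n => S.typePMF.toMeasure) (X := fun _ i => S.W i j)
            fun _ => hmem _ _
      _ ≤ ∑ u : Fin n, S.totalWeight ^ 2 := by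
          refine Finset.sum_le_sum fun u _ => ?_
          refine (variance_le_sq_of_bounded (a := 0) (b := S.totalWeight)
            (Eventually.of_forall fun i => ⟨S.W_nonneg i j, S.W_le_totalWeight i j⟩)
            Measurable.of_discrete.aemeasurable).trans ?_
          nlinarith [sq_nonneg S.totalWeight]
      _ = _ := by simp
  have hcheb := meas_ge_le_variance_div_sq (hmem (S.typesLaw n) X)
    (c := n * (α * δ)) (by positivity)
  refine (measure_mono ?_).trans (hcheb.trans (ENNReal.ofReal_le_ofReal ?_))
  · intro σ hσ
    rw [Set.mem_ofPred_eq, ← hXa] at hσ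
    rw [Set.mem_ofPred_eq, hmean]
    refine le_trans ?_ (le_abs_self _)
    linarith
  · calc Var[X; S.typesLaw n] / (n * (α * δ)) ^ 2
        ≤ (n * S.totalWeight ^ 2) / (n * (α * δ)) ^ 2 := by gcongr
      _ = _ := by field_simp

theorem sum_edgeProb_le {n : ℕ} (hn : 0 < n) {a : ℝ} (σ : Fin n → Fin r)
    (h : ∀ j, ∑ u, S.W (σ u) j ≤ n * a) (u : Fin n) : ∑ v, S.edgeProb σ s(u, v) ≤ a := by
  have hn' : (0 : ℝ) < n := by exact_mod_cast hn
  calc ∑ v, S.edgeProb σ s(u, v) ≤ ∑ v, S.W (σ v) (σ u) / n := by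
        refine Finset.sum_le_sum fun v _ => ?_
        rw [S.W_symm.apply (σ u) (σ v)]
        exact min_le_left _ _
    _ = (∑ v, S.W (σ v) (σ u)) / n := by rw [Finset.sum_div]
    _ ≤ a := by rw [div_le_iff₀ hn', mul_comm]; exact h _

theorem edgeProb_le {n : ℕ} (σ : Fin n → Fin r) (e : Sym2 (Fin n)) :
    S.edgeProb σ e ≤ S.totalWeight / n := by
  induction e with
  | h u v =>
    exact (min_le_left _ _).trans
      (div_le_div_of_nonneg_right (S.W_le_totalWeight _ _) (Nat.cast_nonneg n))

theorem law_le_of_edgeLaw_le {n : ℕ} (s : Set ((Fin n → Fin r) × (Sym2 (Fin n) → Bool)))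
    (t : Set (Fin n → Fin r)) {ε : ENNReal}
    (h : ∀ σ ∉ t, S.edgeLaw σ (Prod.mk σ ⁻¹' s) ≤ ε) :
    S.law n s ≤ S.typesLaw n t + ε := by
  rw [law, Measure.compProd_apply .of_discrete]
  calc ∫⁻ σ, S.edgeKernel n σ (Prod.mk σ ⁻¹' s) ∂S.typesLaw n
      ≤ ∫⁻ σ, t.indicator 1 σ + ε ∂S.typesLaw n := by
        refine lintegral_mono fun σ => ?_
        by_cases hσ : σ ∈ t
        · rw [Set.indicator_of_mem hσ]
          exact (prob_le_one (μ := S.edgeLaw σ)).trans le_self_add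
        · rw [Set.indicator_of_notMem hσ, zero_add]
          exact h σ hσ
    _ = _ := by
        rw [lintegral_add_right _ measurable_const, lintegral_indicator_one .of_discrete]
        simp

theorem law_specRadius_gt_le {α : ℝ} (hα : 1 ≤ α) (hdeg : ∀ j, ∑ i, S.meanProgeny i j = α)
    {n : ℕ} (hn : 0 < n) {δ : ℝ} (hδ : 0 < δ) (ℓ : ℕ) {L : ℝ} (hL : 0 ≤ L) :
    S.law n {x | ¬ (pathExpansionMatrix (graphOf x.2) ℓ -
        distanceMatrix (graphOf x.2) ℓ).specRadius ≤
          ENNReal.ofReal (3 * L * (ℓ + 1) ^ 2 * (α * (1 + δ)) ^ ((ℓ : ℝ) / 2))} ≤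
      ENNReal.ofReal (r * (S.totalWeight ^ 2 / (n * (α * δ) ^ 2)) +
        (n * ((ℓ + 1) * Real.exp (1 - L)) +
          n * ((8 * ℓ + 1) ^ 12 * (α * (1 + δ)) ^ (8 * ℓ) * (S.totalWeight / n) ^ 2))) := by
  have hα0 : 0 < α := by linarith
  have ha : 1 ≤ α * (1 + δ) := by nlinarith
  rw [ENNReal.ofReal_add (by positivity) (by positivity)]
  let t : Set (Fin n → Fin r) := ⋃ j : Fin r, {σ | n * (α * (1 + δ)) ≤ ∑ u, S.W (σ u) j}
  refine (S.law_le_of_edgeLaw_le _ t ?_).trans (add_le_add ?_ le_rfl)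
  · intro σ hσ
    have hσ' : ∀ j, ∑ u, S.W (σ u) j ≤ n * (α * (1 + δ)) := by
      intro j
      by_contra hcon
      exact hσ (Set.mem_iUnion.2 ⟨j, (not_le.1 hcon).le⟩)
    have := real_specRadius_gt_le (fun e => ⟨S.edgeProb σ e, S.edgeProb_mem σ e⟩) ha
      (S.sum_edgeProb_le hn σ hσ') (S.edgeProb_le σ) ℓ hL
    rw [measureReal_def] at this
    exact (ENNReal.le_ofReal_iff_toReal_le (measure_ne_top _ _) (by positivity)).2 this
  · calc S.typesLaw n t ≤ ∑ j : Fin r, S.typesLaw n {σ | n * (α * (1 + δ)) ≤ ∑ u, S.W (σ u) j} :=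
          measure_iUnion_fintype_le _ _
      _ ≤ ∑ j : Fin r, ENNReal.ofReal (S.totalWeight ^ 2 / (n * (α * δ) ^ 2)) :=
          Finset.sum_le_sum fun j _ => S.typesLaw_degree_ge_le hα0 hdeg hn hδ j
      _ = _ := by
          rw [Finset.sum_const, Finset.card_univ, Fintype.card_fin, nsmul_eq_mul,
            ENNReal.ofReal_mul (Nat.cast_nonneg r), ENNReal.ofReal_natCast]

end SBM

/-! ### Asymptotics and conclusion. -/

theorem eventually_le_logb_div_twelve {α : ℝ} (hα : 1 < α) {κ : ℝ} (hκ : κ < 1 / 12) {ℓ : ℕ → ℕ}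
    (hℓ : (fun n => (ℓ n : ℝ)) ~[atTop] (fun n : ℕ => κ * Real.logb α n)) :
    ∀ᶠ n : ℕ in atTop, (ℓ n : ℝ) ≤ Real.logb α n / 12 := by
  have hlog : ∀ᶠ n : ℕ in atTop, 0 ≤ Real.logb α n := by
    filter_upwards [eventually_ge_atTop 1] with n hn
    exact Real.logb_nonneg hα (by exact_mod_cast hn)
  obtain ⟨ε, hε, hκε⟩ : ∃ ε > 0, κ + ε * |κ| ≤ 1 / 12 := by
    refine ⟨(1 / 12 - κ) / (|κ| + 1), by have := abs_nonneg κ; apply div_pos <;> linarith, ?_⟩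
    have h1 : (1 / 12 - κ) / (|κ| + 1) * |κ| ≤ 1 / 12 - κ := by
      rw [div_mul_eq_mul_div, div_le_iff₀ (by positivity)]
      have : 0 ≤ 1 / 12 - κ := by linarith
      nlinarith [abs_nonneg κ]
    linarith
  filter_upwards [hlog, hℓ.def hε] with n hn h
  simp only [Pi.sub_apply, Real.norm_eq_abs, abs_mul, abs_of_nonneg hn] at h
  have h2 := (abs_le.1 h).2
  nlinarith

theorem tendsto_log_pow_mul_rpow_neg (A : ℝ) (k : ℕ) {s : ℝ} (hs : 0 < s) :
    Tendsto (fun n : ℕ => (A * Real.log n) ^ k * (n : ℝ) ^ (-s)) atTop (𝓝 0) := by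
  have h := (isLittleO_log_rpow_rpow_atTop (k : ℝ) hs).tendsto_div_nhds_zero
  have h2 := (h.const_mul (A ^ k)).comp tendsto_natCast_atTop_atTop
  rw [mul_zero] at h2
  refine h2.congr fun n => ?_
  simp only [Function.comp_apply]
  rw [Real.rpow_natCast, Real.rpow_neg (Nat.cast_nonneg n), mul_pow]
  ring

theorem mainTheorem6 {r : ℕ} (S : SBM r) (α : ℝ)
    (hα : 1 < α)
    (hprim : S.meanProgeny.IsPrimitive)
    (hdeg : ∀ j, ∑ i, S.meanProgeny i j = α)
    (κ : ℝ) (hκ : κ < 1 / 12) (ℓ : ℕ → ℕ)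
    (hℓ : (fun n => (ℓ n : ℝ)) ~[atTop] (fun n : ℕ => κ * Real.logb α n)) :
    ∃ C c : ℝ, Tendsto
      (fun n : ℕ => S.law n {x |
        (pathExpansionMatrix (graphOf x.2) (ℓ n) - distanceMatrix (graphOf x.2) (ℓ n)).specRadius
          ≤ ENNReal.ofReal (C * Real.log n ^ c * α ^ ((ℓ n : ℝ) / 2))})
      atTop (𝓝 1) := by
  have hα0 : 0 < α := by linarith
  have hlα : 0 < Real.log α := Real.log_pos hα
  set A : ℝ := 1 / (12 * Real.log α) with hA
  have hA0 : 0 < A := by positivity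
  set K := S.totalWeight with hK
  -- The three terms bound the failure of degree concentration, of sphere growth, and of the
  -- almost-tree property.
  let err : ℕ → ℝ := fun n => r * K ^ 2 / α ^ 2 * ((1 * Real.log n) ^ 2 * (n : ℝ) ^ (-1 : ℝ)) +
    (Real.exp 1 * (((A + 1) * Real.log n) ^ 1 * (n : ℝ) ^ (-1 : ℝ)) +
      K ^ 2 * Real.exp (8 * A) * (((8 * (A + 1)) * Real.log n) ^ 12 * (n : ℝ) ^ (-(1 / 3) : ℝ)))
  have herr : Tendsto err atTop (𝓝 0) := by
    have h1 := (tendsto_log_pow_mul_rpow_neg 1 2 one_pos).const_mul (r * K ^ 2 / α ^ 2)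
    have h2 := (tendsto_log_pow_mul_rpow_neg (A + 1) 1 one_pos).const_mul (Real.exp 1)
    have h3 := (tendsto_log_pow_mul_rpow_neg (8 * (A + 1)) 12
      (by norm_num : (0 : ℝ) < 1 / 3)).const_mul (K ^ 2 * Real.exp (8 * A))
    have h := h1.add (h2.add h3)
    simp only [mul_zero, add_zero] at h
    exact h
  -- From `3 L (ℓ+1)²` with `L = 2 log n` and `ℓ + 1 ≤ (A+1) log n`; the exponential pays for `(1 +
  -- 1/log n)^(ℓ/2)`.
  refine ⟨6 * (A + 1) ^ 2 * Real.exp (A / 2), 3, ?_⟩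
  have hlog1 : ∀ᶠ n : ℕ in atTop, 1 ≤ Real.log n :=
    (Real.tendsto_log_atTop.comp tendsto_natCast_atTop_atTop).eventually_ge_atTop 1
  have hmain : ∀ᶠ n : ℕ in atTop, S.law n {x |
      (pathExpansionMatrix (graphOf x.2) (ℓ n) - distanceMatrix (graphOf x.2) (ℓ n)).specRadius
        ≤ ENNReal.ofReal (6 * (A + 1) ^ 2 * Real.exp (A / 2) * Real.log n ^ (3 : ℝ) *
          α ^ ((ℓ n : ℝ) / 2))}ᶜ ≤ ENNReal.ofReal (err n) := by
    filter_upwards [hlog1, eventually_le_logb_div_twelve hα hκ hℓ, eventually_ge_atTop 1]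
      with n hlog hle hn
    have hn0 : (0 : ℝ) < n := by exact_mod_cast hn
    set lam := Real.log n with hlam
    have hlam0 : 0 < lam := by linarith
    have hℓA : (ℓ n : ℝ) ≤ A * lam := by
      refine hle.trans (le_of_eq ?_)
      rw [Real.logb, hA]
      field_simp
      exact hlam.symm
    have hℓ1 : (ℓ n : ℝ) + 1 ≤ (A + 1) * lam := by nlinarith
    have hgrow : ∀ m : ℝ, 0 ≤ m → (1 + 1 / lam) ^ (m * ℓ n) ≤ Real.exp (m * A) := by
      intro m hm
      calc (1 + 1 / lam) ^ (m * ℓ n) ≤ Real.exp (1 / lam) ^ (m * ℓ n) := by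
            have := Real.add_one_le_exp (1 / lam)
            gcongr
            linarith
        _ = Real.exp (1 / lam * (m * ℓ n)) := by rw [← Real.exp_mul]
        _ ≤ Real.exp (m * A) := by
            apply Real.exp_le_exp.2
            calc 1 / lam * (m * ℓ n) ≤ 1 / lam * (m * (A * lam)) := by gcongr
              _ = m * A := by field_simp
    -- Here `ℓ ≤ log_α n / 12` enters: `8/12 = 2/3 < 1` beats the remaining factor `1/n`.
    have hαpow : α ^ (8 * ℓ n) ≤ (n : ℝ) ^ (2 / 3 : ℝ) := by
      rw [← Real.rpow_natCast, Real.rpow_def_of_pos hα0, Real.rpow_def_of_pos hn0]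
      apply Real.exp_le_exp.2
      have e : A * lam * (12 * Real.log α) = lam := by rw [hA]; field_simp
      push_cast
      nlinarith
    -- `δ = 1/log n` is small enough that `(1+δ)^ℓ` stays bounded and large enough for Chebyshev; `L
    -- = 2 log n` makes each sphere tail `e/n²`, enough for the union bound.
    have hbound := S.law_specRadius_gt_le hα.le hdeg hn (δ := 1 / lam) (by positivity) (ℓ n)
      (L := 2 * lam) (by positivity)
    refine (measure_mono ?_).trans (hbound.trans (ENNReal.ofReal_le_ofReal ?_))
    · intro x hx hgood
      apply hx
      rw [Set.mem_ofPred_eq]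
      refine hgood.trans (ENNReal.ofReal_le_ofReal ?_)
      have hg := hgrow (1 / 2) (by norm_num)
      rw [Real.mul_rpow hα0.le (by positivity)]
      have e1 : (ℓ n : ℝ) / 2 = 1 / 2 * ℓ n := by ring
      have e2 : lam ^ (3 : ℝ) = lam ^ 3 := by
        rw [← Real.rpow_natCast]; norm_num
      rw [e2]
      calc 3 * (2 * lam) * ((ℓ n : ℝ) + 1) ^ 2 *
            (α ^ ((ℓ n : ℝ) / 2) * (1 + 1 / lam) ^ ((ℓ n : ℝ) / 2))
          ≤ 3 * (2 * lam) * ((A + 1) * lam) ^ 2 * (α ^ ((ℓ n : ℝ) / 2) * Real.exp (1 / 2 * A)) := by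
            rw [e1]
            gcongr
        _ = _ := by
            rw [show 1 / 2 * A = A / 2 by ring]; ring
    · refine add_le_add (le_of_eq ?_) (add_le_add ?_ ?_)
      · rw [Real.rpow_neg_one]
        field_simp
        rw [hlam, hK]
      · have e1 : Real.exp (1 - 2 * lam) = Real.exp 1 * ((n : ℝ) ^ 2)⁻¹ := by
          rw [sub_eq_add_neg, Real.exp_add, Real.exp_neg, two_mul, Real.exp_add, hlam,
            Real.exp_log hn0, sq]
        rw [e1, Real.rpow_neg_one, pow_one]
        calc (n : ℝ) * (((ℓ n : ℝ) + 1) * (Real.exp 1 * ((n : ℝ) ^ 2)⁻¹))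
            = Real.exp 1 * (((ℓ n : ℝ) + 1) * (n : ℝ)⁻¹) := by field_simp
          _ ≤ _ := by gcongr
      · have hg := hgrow 8 (by norm_num)
        have e0 : (1 + 1 / lam) ^ (8 * ℓ n) ≤ Real.exp (8 * A) := by
          rw [← Real.rpow_natCast]
          push_cast
          exact hg
        have e3 : 8 * (ℓ n : ℝ) + 1 ≤ 8 * (A + 1) * lam := by nlinarith
        have e4 : (n : ℝ) ^ (-(1 / 3) : ℝ) = (n : ℝ) ^ (2 / 3 : ℝ) * (n : ℝ)⁻¹ := by
          rw [← Real.rpow_neg_one, ← Real.rpow_add hn0]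
          norm_num
        rw [mul_pow, e4]
        calc (n : ℝ) * ((8 * (ℓ n : ℝ) + 1) ^ 12 * (α ^ (8 * ℓ n) * (1 + 1 / lam) ^ (8 * ℓ n)) *
              (K / n) ^ 2)
            ≤ (n : ℝ) * ((8 * (A + 1) * lam) ^ 12 * ((n : ℝ) ^ (2 / 3 : ℝ) * Real.exp (8 * A)) *
              (K / n) ^ 2) := by gcongr
          _ = _ := by field_simp; rw [hlam]; ring
  have hlower : Tendsto (fun n => 1 - ENNReal.ofReal (err n)) atTop (𝓝 1) := by
    have h1 : Tendsto (fun n => ENNReal.ofReal (err n)) atTop (𝓝 0) := by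
      simpa using ENNReal.tendsto_ofReal herr
    simpa using ENNReal.Tendsto.sub (tendsto_const_nhds (x := (1 : ENNReal))) h1
      (Or.inl ENNReal.one_ne_top)
  refine tendsto_of_tendsto_of_tendsto_of_le_of_le' hlower tendsto_const_nhds ?_
    (Eventually.of_forall fun n => prob_le_one)
  filter_upwards [hmain] with n hn
  rw [tsub_le_iff_right]
  calc (1 : ENNReal) = S.law n Set.univ := measure_univ.symm
    _ ≤ _ := (measure_univ_le_add_compl _).trans (add_le_add le_rfl hn)
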